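/- Let $K_n$ denote the complete graph on the vertex set $\{1,\dots,n\}$. A labeling $c:E(K_n)\to\{+1,-1\}$ is called balanced if equally many edges have label $+1$ (plus-edges) and label $-1$. For a subgraph $H$ of $K_n$, let $m^+(H)$ be the number of plus-edges of $H$. A $C_3$-factor of $K_n$ is a spanning subgraph of $K_n$ all of whose connected components are triangles. (i) There is a function $f:\mathbb{N}\to\mathbb{R}$ with $f(n)=o(n)$ as $n\to\infty$ such that, for every $n\ge 4$ and every balanced labeling $c:E(K_n)\to\{\pm1\}$, there is a Hamiltonian cycle $C$ of $K_n$ with $$m^+(C)\ \ge\ \left(2-\sqrt2\right)n-f(n)\qquad (2-\sqrt 2\approx 0.58).$$ (ii) There is a function $f:\mathbb{N}\to\mathbb{R}$ with $f(n)=o(n)$ as $n\to\infty$ such that, for every $n$ divisible by $3$ and every balanced labeling $c:E(K_n)\to\{\pm1\}$, there is a $C_3$-factor $F$ of $K_n$ with $$m^+(F)\ \ge\ \left(\frac{3\sqrt2}{4}-\frac12\right)n-f(n)\qquad \left(\tfrac{3\sqrt2}{4}-\tfrac12\approx 0.56\right).$$ -/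

import Mathlib

open scoped Asymptotics

/-- `labelCount c H s` is the number of edges of the spanning subgraph `H` of the complete graph on
`V` whose label under the `±1`-edge labeling `c` of the complete graph equals `s`. Labels are taken
in `ℤˣ = {1, -1}`. -/
noncomputable def labelCount {V : Type*} (c : SimpleGraph.TopEdgeLabeling V ℤˣ)
    (H : SimpleGraph V) (s : ℤˣ) : ℕ :=
  Set.ncard {e : (⊤ : SimpleGraph V).edgeSet | (e : Sym2 V) ∈ H.edgeSet ∧ c e = s}

/-- The number of plus-edges of `H`. -/
noncomputable def plusCount {V : Type*} (c : SimpleGraph.TopEdgeLabeling V ℤˣ)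
    (H : SimpleGraph V) : ℕ :=
  labelCount c H 1

/-- The number of minus-edges of `H`. -/
noncomputable def minusCount {V : Type*} (c : SimpleGraph.TopEdgeLabeling V ℤˣ)
    (H : SimpleGraph V) : ℕ :=
  labelCount c H (-1)

/-- The labeling is balanced: the complete graph has equally many plus-edges and minus-edges. -/
def IsBalancedLabeling {V : Type*} (c : SimpleGraph.TopEdgeLabeling V ℤˣ) : Prop :=
  plusCount c ⊤ = minusCount c ⊤

/-- A `C₃`-factor of the complete graph on `V`: a spanning subgraph all of whose components are
triangles. -/
def IsTriangleFactor {V : Type*} (F : SimpleGraph V) : Prop :=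
  ∀ C : F.ConnectedComponent, Nonempty (C.toSimpleGraph ≃g SimpleGraph.cycleGraph 3)

/-! Let `G` be the graph of plus-edges. Balance says exactly that its degrees sum to n(n-1)/2, and
both parts hold for every graph with this degree sum. Edges are counted by real indicators over
ordered pairs.

Hamiltonian cycles: suppose every cyclic order of the vertices contains at most `L` edges of `G`,
and enlarge `G` to an edge-maximal graph with this property. As in the Bondy–Chvátal closure,
nonadjacent vertices then have degree sum at most `L` (`degree_sum_le_of_maximal`): a missing edge
would create an order with more than `L` edges; opened there, it becomes a path on which no 2-opt
exchange is profitable, and summing over all exchanges bounds the two degrees. A Chvátal-type count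
(`sum_degree_le_of_closed`) bounds the total degree by nL - L²/4 + L. Since nL - L²/4 = n²/2 at L =
(2 - √2)n, a slightly smaller `L` is impossible.

Triangle factors: take a maximum matching of `G`. If it has at least n/3 edges, keep n/3 of them.
Either extending each by an unmatched vertex or tiling the matched and unmatched vertices separately
yields about 17n/30 edges on average (`hasPartialTiling_of_large_matching`). Otherwise split the
matching into `S`, the edges with an endpoint that has two uncovered neighbours, and the rest `N`.
Augmenting paths limit the edges inside `S`, between `S` and `N`, and at the uncovered set `U`
(`edgeSum_bounds`). Extending `S` into `U` and regrouping `N` in threes profits from the edges that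
remain, and `tiling_bound_of_edge_bounds` shows that this suffices.

All losses are bounded, so both error functions are constants. -/

open SimpleGraph Finset

/-! ### Adjacency indicators and labelled edge counts -/

/-- The indicator of adjacency, as a real number. -/
noncomputable def adjInd {V : Type*} (G : SimpleGraph V) (a b : V) : ℝ :=
  open Classical in if G.Adj a b then 1 else 0

section Indicator

variable {V : Type*} {G : SimpleGraph V}

lemma adjInd_of_adj {a b : V} (h : G.Adj a b) : adjInd G a b = 1 := by
  simp [adjInd, h]

lemma adjInd_of_not_adj {a b : V} (h : ¬ G.Adj a b) : adjInd G a b = 0 := by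
  simp [adjInd, h]

lemma adjInd_self (a : V) : adjInd G a a = 0 := by
  simp [adjInd]

lemma adjInd_comm (a b : V) : adjInd G a b = adjInd G b a := by
  by_cases h : G.Adj a b
  · simp [adjInd, h, h.symm]
  · simpa [adjInd, h] using fun h' : G.Adj b a => h h'.symm

lemma adjInd_nonneg (a b : V) : 0 ≤ adjInd G a b := by
  unfold adjInd; split_ifs <;> norm_num

lemma adjInd_le_one (a b : V) : adjInd G a b ≤ 1 := by
  unfold adjInd; split_ifs <;> norm_num

lemma adjInd_mono {G' : SimpleGraph V} (h : G ≤ G') (a b : V) : adjInd G a b ≤ adjInd G' a b := by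
  by_cases hab : G.Adj a b
  · rw [adjInd_of_adj hab, adjInd_of_adj (h hab)]
  · rw [adjInd_of_not_adj hab]; exact adjInd_nonneg _ _

end Indicator

section Labels

variable {V : Type*}

lemma labelCount_eq_ncard (c : TopEdgeLabeling V ℤˣ) (H : SimpleGraph V) (s : ℤˣ) :
    labelCount c H s = (H.edgeSet ∩ (c.labelGraph s).edgeSet).ncard := by
  unfold labelCount
  rw [← Set.ncard_image_of_injective _ Subtype.val_injective]
  congr 1
  ext e
  induction e using Sym2.inductionOn with
  | hf x y =>
    simp only [Set.mem_image, Set.mem_ofPred_eq, Subtype.exists, Set.mem_inter_iff, mem_edgeSet,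
      EdgeLabeling.labelGraph_adj]
    constructor
    · rintro ⟨e, he, ⟨h1, h2⟩, rfl⟩
      exact ⟨h1, he, h2⟩
    · rintro ⟨h1, h, h2⟩
      exact ⟨s(x, y), h, ⟨h1, h2⟩, rfl⟩

lemma sum_adjInd_eq_two_mul_ncard [Fintype V] (G : SimpleGraph V) :
    ∑ a, ∑ b, adjInd G a b = 2 * (G.edgeSet.ncard : ℝ) := by
  classical
  have h := G.sum_degrees_eq_twice_card_edges
  have h2 : ∀ a, ∑ b, adjInd G a b = (G.degree a : ℝ) := by
    intro a
    simp only [adjInd]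
    rw [Finset.sum_boole]
    rw [← G.card_neighborFinset_eq_degree, neighborFinset_eq_filter]
  simp only [h2]
  rw [← Nat.cast_sum, h, ← coe_edgeFinset, Set.ncard_coe_finset]
  push_cast; rfl

/-- The indicators of the two labels add up to 1 off the diagonal and have equal totals. Balance
enters the proof only here. -/
lemma sum_adjInd_of_isBalancedLabeling [Fintype V] {c : TopEdgeLabeling V ℤˣ}
    (h : IsBalancedLabeling c) :
    ∑ a, ∑ b, adjInd (c.labelGraph 1) a b
      = (Fintype.card V : ℝ) * ((Fintype.card V : ℝ) - 1) / 2 := by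
  classical
  have hsum : ∀ a b : V, adjInd (c.labelGraph 1) a b + adjInd (c.labelGraph (-1)) a b
      = if a = b then 0 else 1 := by
    intro a b
    by_cases hab : a = b
    · subst hab; simp [adjInd_self]
    · rcases Int.units_eq_one_or (c.get a b hab) with h1 | h1
      · rw [adjInd_of_adj ((TopEdgeLabeling.labelGraph_adj a b).2 ⟨hab, h1⟩),
          adjInd_of_not_adj]
        · simp [hab]
        · rw [TopEdgeLabeling.labelGraph_adj]
          rintro ⟨_, h2⟩
          rw [h1] at h2
          exact absurd h2 (by decide)
      · rw [adjInd_of_not_adj, adjInd_of_adj ((TopEdgeLabeling.labelGraph_adj a b).2 ⟨hab, h1⟩)]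
        · simp [hab]
        · rw [TopEdgeLabeling.labelGraph_adj]
          rintro ⟨_, h2⟩
          rw [h1] at h2
          exact absurd h2 (by decide)
  have htot : ∑ a, ∑ b, adjInd (c.labelGraph 1) a b + ∑ a, ∑ b, adjInd (c.labelGraph (-1)) a b
      = (Fintype.card V : ℝ) * ((Fintype.card V : ℝ) - 1) := by
    rw [← Finset.sum_add_distrib]
    simp only [← Finset.sum_add_distrib, hsum]
    have : ∀ a : V, ∑ b : V, (if a = b then (0 : ℝ) else 1) = (Fintype.card V : ℝ) - 1 := by
      intro a
      have : ∀ b : V, (if a = b then (0 : ℝ) else 1) = 1 - if a = b then 1 else 0 := by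
        intro b; split_ifs <;> norm_num
      simp [this, Finset.sum_sub_distrib]
    simp only [this, Finset.sum_const, Finset.card_univ, nsmul_eq_mul]
  have heq : ∑ a, ∑ b, adjInd (c.labelGraph 1) a b = ∑ a, ∑ b, adjInd (c.labelGraph (-1)) a b := by
    rw [sum_adjInd_eq_two_mul_ncard, sum_adjInd_eq_two_mul_ncard]
    unfold IsBalancedLabeling plusCount minusCount at h
    rw [labelCount_eq_ncard, labelCount_eq_ncard,
      Set.inter_eq_right.2 (edgeSet_mono le_top),
      Set.inter_eq_right.2 (edgeSet_mono le_top)] at h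
    rw [h]
  linarith

end Labels

/-! ### Sums along lists and cyclic orders -/

/-- The sum of `f` over the consecutive pairs of a list. -/
def consecSum {V : Type*} (f : V → V → ℝ) : List V → ℝ
  | [] => 0
  | [_] => 0
  | a :: b :: l => f a b + consecSum f (b :: l)

/-- The sum of `f` over the cyclically consecutive pairs of a list. -/
def cycleSum {V : Type*} (f : V → V → ℝ) (l : List V) : ℝ :=
  consecSum f (l ++ l.head?.toList)

section ConsecSum

variable {V : Type*} {f : V → V → ℝ}

lemma consecSum_append_cons (p : List V) (a : V) (q : List V) :
    consecSum f (p ++ a :: q) = consecSum f (p ++ [a]) + consecSum f (a :: q) := by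
  induction p with
  | nil => simp [consecSum]
  | cons b p ih =>
    cases p with
    | nil => simp [consecSum]
    | cons c p =>
      simp only [List.cons_append, consecSum] at ih ⊢
      rw [ih]; ring

lemma consecSum_append_cons_cons (p : List V) (a b : V) (q : List V) :
    consecSum f (p ++ a :: b :: q) = consecSum f (p ++ [a]) + f a b + consecSum f (b :: q) := by
  rw [consecSum_append_cons, consecSum]; ring

lemma consecSum_reverse (hf : ∀ a b, f a b = f b a) (l : List V) :
    consecSum f l.reverse = consecSum f l := by
  induction l with
  | nil => rfl
  | cons a l ih =>
    cases l with
    | nil => rfl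
    | cons b l =>
      rw [consecSum, ← ih, List.reverse_cons, List.reverse_cons, List.append_assoc,
        List.singleton_append, consecSum_append_cons_cons, hf b a]
      simp [consecSum]; ring

lemma consecSum_le_consecSum {g : V → V → ℝ} {l : List V}
    (h : ∀ p x y q, l = p ++ x :: y :: q → f x y ≤ g x y) : consecSum f l ≤ consecSum g l := by
  induction l with
  | nil => exact le_rfl
  | cons a l ih =>
    cases l with
    | nil => exact le_rfl
    | cons b l =>
      refine add_le_add (h [] a b l rfl) (ih fun p x y q hl => h (a :: p) x y q ?_)
      rw [hl]; rfl

lemma consecSum_nonneg (hf : ∀ a b, 0 ≤ f a b) (l : List V) : 0 ≤ consecSum f l := by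
  induction l with
  | nil => exact le_rfl
  | cons a l ih =>
    cases l with
    | nil => exact le_rfl
    | cons b l => exact add_nonneg (hf a b) ih

lemma consecSum_le_append (hf : ∀ a b, 0 ≤ f a b) (l m : List V) :
    consecSum f l ≤ consecSum f (l ++ m) := by
  rcases l.eq_nil_or_concat with rfl | ⟨p, a, rfl⟩
  · exact consecSum_nonneg hf _
  · simp only [List.concat_eq_append, List.append_assoc, List.singleton_append]
    rw [consecSum_append_cons p a m]
    linarith [consecSum_nonneg hf (a :: m)]

lemma consecSum_add (h₁ h₂ : V → ℝ) (a : V) (l : List V) :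
    consecSum (fun x y => h₁ x + h₂ y) (a :: l)
      = ((a :: l).dropLast.map h₁).sum + (l.map h₂).sum := by
  induction l generalizing a with
  | nil => simp [consecSum]
  | cons b l ih =>
    rw [consecSum, ih]
    simp; ring

lemma exists_nat_eq_consecSum (G : SimpleGraph V) (l : List V) :
    ∃ k : ℕ, consecSum (adjInd G) l = k := by
  induction l with
  | nil => exact ⟨0, by simp [consecSum]⟩
  | cons a l ih =>
    cases l with
    | nil => exact ⟨0, by simp [consecSum]⟩
    | cons b l =>
      obtain ⟨k, hk⟩ := ih
      rw [consecSum, hk]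
      by_cases h : G.Adj a b
      · exact ⟨1 + k, by rw [adjInd_of_adj h]; push_cast; rfl⟩
      · exact ⟨k, by rw [adjInd_of_not_adj h]; ring⟩

/-- Rotation invariance, in the form that turns a chosen consecutive pair into the closing pair. -/
lemma cycleSum_append_comm (p : List V) (x y : V) (q : List V) :
    cycleSum f (p ++ x :: y :: q) = cycleSum f (y :: q ++ (p ++ [x])) := by
  cases p with
  | nil =>
    simp only [cycleSum, List.nil_append, List.cons_append, List.head?_cons, Option.toList_some,
      List.append_assoc, consecSum]
    have := consecSum_append_cons_cons (f := f) (y :: q) x y []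
    simp only [List.cons_append, consecSum] at this
    rw [this]; ring
  | cons h p =>
    simp only [cycleSum, List.cons_append, List.head?_cons, Option.toList_some,
      List.append_assoc, List.nil_append]
    have h1 := consecSum_append_cons_cons (f := f) (h :: p) x y (q ++ [h])
    have h2 := consecSum_append_cons (f := f) (y :: q) h (p ++ [x, y])
    have h3 := consecSum_append_cons_cons (f := f) (h :: p) x y []
    simp only [List.cons_append, consecSum] at h1 h2 h3
    rw [h1, h2, h3]; ring

end ConsecSum

/-! ### 2-opt exchanges and the closure -/

/-- A list that contains every vertex exactly once. -/
def IsFullList {V : Type*} (l : List V) : Prop :=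
  l.Nodup ∧ ∀ v, v ∈ l

section TwoOpt

variable {V : Type*} {G : SimpleGraph V}

lemma IsFullList.perm {l m : List V} (h : IsFullList l) (hp : m.Perm l) : IsFullList m :=
  ⟨hp.nodup_iff.2 h.1, fun v => hp.mem_iff.2 (h.2 v)⟩

lemma IsFullList.sum_map [Fintype V] {l : List V} (h : IsFullList l) (f : V → ℝ) :
    (l.map f).sum = ∑ v, f v := by
  classical
  rw [← List.sum_toFinset f h.1]
  congr 1
  ext v; simp [h.2 v]

/-- Reversing a final segment of an optimal cyclic order gains nothing. -/
lemma adjInd_add_adjInd_le_of_cycleSum_le {L : ℝ}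
    (hL : ∀ l, IsFullList l → cycleSum (adjInd G) l ≤ L) {l : List V} (hl : IsFullList l) {u v : V}
    (hv : l.head? = some v) (hu : l.getLast? = some u) (hlL : L ≤ consecSum (adjInd G) l)
    {p q : List V} {x y : V} (hs : l = p ++ x :: y :: q) :
    adjInd G x u + adjInd G y v ≤ adjInd G x y := by
  have hfull : IsFullList (p ++ x :: (y :: q).reverse) := hl.perm <| by
    rw [hs]
    exact List.Perm.append_left _ (List.Perm.cons _ (List.reverse_perm _))
  have hhead : (p ++ x :: (y :: q).reverse).head? = some v := by
    rw [← hv, hs]; cases p <;> simp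
  have h1 := hL _ hfull
  rw [cycleSum, hhead] at h1
  obtain ⟨r, hr⟩ : ∃ r, y :: q = r ++ [u] := by
    rw [hs, List.getLast?_append] at hu
    have hne : x :: y :: q ≠ [] := by simp
    rw [List.getLast?_eq_getLast_of_ne_nil hne] at hu
    simp only [Option.some_or, Option.some.injEq, List.getLast_cons_cons] at hu
    refine ⟨(y :: q).dropLast, ?_⟩
    rw [← hu, List.dropLast_append_getLast]
  have h2 : consecSum (adjInd G) (p ++ x :: (y :: q).reverse ++ (some v).toList)
      = consecSum (adjInd G) (p ++ [x]) + adjInd G x u + consecSum (adjInd G) (y :: q)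
        + adjInd G y v := by
    have e1 : (y :: q).reverse = u :: r.reverse := by rw [hr]; simp
    have e2 : consecSum (adjInd G) ((y :: q).reverse ++ [v])
        = consecSum (adjInd G) (y :: q) + adjInd G y v := by
      rw [List.reverse_cons, List.append_assoc, List.singleton_append, consecSum_append_cons_cons,
        ← List.reverse_cons, consecSum_reverse adjInd_comm]
      simp [consecSum]
    rw [add_assoc _ (consecSum (adjInd G) (y :: q)), ← e2, e1, List.append_assoc,
      List.cons_append, List.cons_append, consecSum_append_cons_cons]
    rfl
  have h3 : consecSum (adjInd G) l
      = consecSum (adjInd G) (p ++ [x]) + adjInd G x y + consecSum (adjInd G) (y :: q) := by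
    rw [hs, consecSum_append_cons_cons]
  linarith

/-- Sum the exchange inequality along the path. The first endpoints miss only `u` and the second
ones only `v`, whose terms vanish as there are no loops. -/
lemma degree_sum_le_of_cycleSum_le [Fintype V] {L : ℝ}
    (hL : ∀ l, IsFullList l → cycleSum (adjInd G) l ≤ L) {l : List V} (hl : IsFullList l) {u v : V}
    (hv : l.head? = some v) (hu : l.getLast? = some u) (hlL : L ≤ consecSum (adjInd G) l) :
    ∑ x, adjInd G x u + ∑ x, adjInd G x v ≤ L := by
  have h1 : consecSum (fun x y => adjInd G x u + adjInd G y v) l ≤ consecSum (adjInd G) l :=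
    consecSum_le_consecSum fun p x y q hs => adjInd_add_adjInd_le_of_cycleSum_le hL hl hv hu hlL hs
  have h2 : consecSum (adjInd G) l ≤ L :=
    (consecSum_le_append adjInd_nonneg _ _).trans (hL l hl)
  cases l with
  | nil => simp at hv
  | cons a t =>
    rw [consecSum_add] at h1
    rw [← hl.sum_map, ← hl.sum_map]
    have ha : a = v := by simpa using hv
    have e1 : ((a :: t).map fun x => adjInd G x v).sum = (t.map fun x => adjInd G x v).sum := by
      simp [ha, adjInd_self]
    have e2 : ((a :: t).map fun x => adjInd G x u).sum
        = ((a :: t).dropLast.map fun x => adjInd G x u).sum := by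
      have hne : a :: t ≠ [] := by simp
      conv_lhs => rw [← List.dropLast_append_getLast hne]
      rw [List.getLast?_eq_getLast_of_ne_nil hne, Option.some.injEq] at hu
      rw [List.map_append, List.sum_append, hu]
      simp [adjInd_self]
    linarith

/-- **Closure**: in a graph that is edge-maximal subject to all Hamiltonian cycles of the complete
graph having at most `L` edges in the graph, nonadjacent vertices have degree sum at most `L`. -/
lemma degree_sum_le_of_maximal [Fintype V] (hcard : 3 ≤ Fintype.card V) {L : ℕ}
    (hG : Maximal (fun H : SimpleGraph V => ∀ l, IsFullList l → cycleSum (adjInd H) l ≤ L) G)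
    {u v : V} (huv : u ≠ v) (hn : ¬ G.Adj u v) :
    ∑ x, adjInd G x u + ∑ x, adjInd G x v ≤ L := by
  classical
  set H : SimpleGraph V := G ⊔ edge u v with hH
  have hHadj : ∀ x y, H.Adj x y → ¬ G.Adj x y → (x = u ∧ y = v) ∨ (x = v ∧ y = u) := by
    intro x y h1 h2
    rw [hH, sup_adj, edge_adj] at h1
    tauto
  obtain ⟨l, hl, hlL⟩ : ∃ l, IsFullList l ∧ (L : ℝ) < cycleSum (adjInd H) l := by
    by_contra! hcon
    have := hG.2 hcon le_sup_left
    exact hn (this (by rw [hH, sup_adj, edge_adj]; exact Or.inr ⟨Or.inl ⟨rfl, rfl⟩, huv⟩))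
  have key : ∀ m : List V, IsFullList m → (L : ℝ) < cycleSum (adjInd H) m → ∀ x y : V,
      H.Adj x y → ¬ G.Adj x y → m.head? = some y → m.getLast? = some x →
      ∑ z, adjInd G z x + ∑ z, adjInd G z y ≤ L := by
    intro m hm hmL x y hxy hnxy hy hx
    refine degree_sum_le_of_cycleSum_le hG.1 hm hy hx ?_
    have h1 : cycleSum (adjInd H) m = consecSum (adjInd H) m + adjInd H x y := by
      obtain ⟨r, rfl⟩ : ∃ r, m = r ++ [x] := List.getLast?_eq_some_iff.1 hx
      rw [cycleSum, hy, List.append_assoc, Option.toList_some, List.singleton_append,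
        consecSum_append_cons_cons]
      simp [consecSum]
    -- The new edge joins the last vertex to the first; with at least three vertices these are not
    -- consecutive in the list, so the opened order uses no new edge.
    have h2 : consecSum (adjInd H) m ≤ consecSum (adjInd G) m := by
      refine consecSum_le_consecSum fun p a b q hs => ?_
      by_cases hab : H.Adj a b
      · by_cases hab' : G.Adj a b
        · rw [adjInd_of_adj hab, adjInd_of_adj hab']
        · exfalso
          have hlen : m.length = Fintype.card V := by
            rw [← List.toFinset_card_of_nodup hm.1]
            have : m.toFinset = univ := by ext z; simp [hm.2 z]
            rw [this, card_univ]
          have hnd := hm.1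
          have hcases : (a = x ∧ b = y) ∨ (a = y ∧ b = x) := by
            have := hHadj a b hab hab'
            have := hHadj x y hxy hnxy
            grind
          rcases hcases with ⟨rfl, rfl⟩ | ⟨rfl, rfl⟩
          · subst hs
            cases p with
            | nil => simp at hy; exact hxy.ne hy
            | cons z p => simp at hy; subst hy; simp at hnd
          · subst hs
            have hp : p = [] := by
              cases p with
              | nil => rfl
              | cons z p => simp at hy; subst hy; simp at hnd
            subst hp
            rcases q.eq_nil_or_concat with rfl | ⟨q', z, rfl⟩
            · simp at hlen; omega
            · have e : [] ++ a :: b :: q'.concat z = (a :: b :: q') ++ [z] := by simp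
              rw [e, List.getLast?_concat, Option.some.injEq] at hx
              subst hx; simp at hnd
      · rw [adjInd_of_not_adj hab]; exact adjInd_nonneg _ _
    -- Integrality: more than `L` edges with the new one means at least `L` without it.
    obtain ⟨k, hk⟩ := exists_nat_eq_consecSum G m
    rw [adjInd_of_adj hxy] at h1
    rw [hk] at h2 ⊢
    have : (L : ℝ) < k + 1 := by linarith
    exact_mod_cast Nat.lt_succ_iff.1 (by exact_mod_cast this)
  obtain ⟨p, x, y, q, hs, hxy⟩ : ∃ p x y q, l ++ l.head?.toList = p ++ x :: y :: q ∧
      ¬ adjInd H x y ≤ adjInd G x y := by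
    by_contra! hcon
    exact absurd (hlL.trans_le (consecSum_le_consecSum hcon)) (not_lt.2 (hG.1 l hl))
  have hxyH : H.Adj x y := by
    by_contra h
    exact hxy (by rw [adjInd_of_not_adj h]; exact adjInd_nonneg _ _)
  have hxyG : ¬ G.Adj x y := fun h => hxy (by rw [adjInd_of_adj hxyH, adjInd_of_adj h])
  have main : ∑ z, adjInd G z x + ∑ z, adjInd G z y ≤ L := by
    obtain ⟨h, t, rfl⟩ : ∃ h t, l = h :: t := by
      cases l with
      | nil => exact absurd (hl.2 u) (by simp)
      | cons h t => exact ⟨h, t, rfl⟩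
    simp only [List.head?_cons, Option.toList_some] at hs
    -- Either the new edge is already the closing pair, or a rotation makes it so.
    rcases q.eq_nil_or_concat with rfl | ⟨q', z, rfl⟩
    · have : h :: t ++ [h] = (p ++ [x]) ++ [y] := by rw [hs]; simp
      obtain ⟨e1, e2⟩ := List.append_inj' this rfl
      refine key _ hl hlL x y hxyH hxyG ?_ ?_
      · simpa using e2
      · rw [e1]; simp
    · have : h :: t ++ [h] = (p ++ x :: y :: q') ++ [z] := by rw [hs]; simp
      obtain ⟨e1, e2⟩ := List.append_inj' this rfl
      rw [e1] at hl hlL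
      refine key (y :: q' ++ (p ++ [x])) (hl.perm ?_) ?_ x y hxyH hxyG (by simp)
        (by rw [← List.append_assoc]; exact List.getLast?_concat)
      · refine List.perm_append_comm.trans ?_
        simp
      · rwa [← cycleSum_append_comm]
  rcases hHadj x y hxyH hxyG with ⟨rfl, rfl⟩ | ⟨rfl, rfl⟩
  · exact main
  · linarith

end TwoOpt

/-! ### Degree sums of closed graphs and the bound for cyclic orders -/

section DegreeSum

variable {V : Type*} [Fintype V] {G : SimpleGraph V}

lemma card_le_sum_adjInd {A : Finset V} {w : V} (h : ∀ v ∈ A, G.Adj v w) :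
    (#A : ℝ) ≤ ∑ x, adjInd G x w := by
  calc (#A : ℝ) = ∑ v ∈ A, adjInd G v w := by
        rw [sum_congr rfl fun v hv => adjInd_of_adj (h v hv)]; simp
    _ ≤ ∑ v, adjInd G v w :=
        sum_le_sum_of_subset_of_nonneg (subset_univ _) fun _ _ _ => adjInd_nonneg _ _

/-- The vertices of degree above `L / 2` form a clique `D`. Let `u` have the largest degree `j`
outside `D`. All vertices of degree above `L - j` are adjacent to `u`, so at most `j` of them exist.
Bounding degrees by `n`, `L - j` and `j` on the three classes leaves a polynomial in `j ≤ L / 2`;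
the end `j = 0` is what needs `5 L ≤ 4 n`. -/
lemma sum_degree_le_of_closed {L : ℝ}
    (hcl : ∀ u v, u ≠ v → ¬ G.Adj u v → ∑ x, adjInd G x u + ∑ x, adjInd G x v ≤ L)
    (hne : ∃ u v, u ≠ v ∧ ¬ G.Adj u v) (hL : 5 * L ≤ 4 * (Fintype.card V : ℝ)) :
    ∑ v, ∑ x, adjInd G x v ≤ Fintype.card V * L - L ^ 2 / 4 + L := by
  classical
  set n : ℝ := (Fintype.card V : ℝ) with hn
  set d : V → ℝ := fun v => ∑ x, adjInd G x v with hd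
  have hd0 : ∀ v, 0 ≤ d v := fun v => sum_nonneg fun _ _ => adjInd_nonneg _ _
  have hdn : ∀ v, d v ≤ n := fun v => by
    calc d v ≤ ∑ _x : V, (1 : ℝ) := sum_le_sum fun _ _ => adjInd_le_one _ _
      _ = n := by simp [hn]
  set D : Finset V := univ.filter fun v => L < 2 * d v with hD
  have hDc : (Dᶜ).Nonempty := by
    obtain ⟨u, v, huv, hadj⟩ := hne
    by_contra hcon
    rw [not_nonempty_iff_eq_empty, compl_eq_empty_iff] at hcon
    have hu : u ∈ D := by rw [hcon]; exact mem_univ _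
    have hv : v ∈ D := by rw [hcon]; exact mem_univ _
    simp only [hD, mem_filter, mem_univ, true_and] at hu hv
    linarith [hcl u v huv hadj]
  obtain ⟨u, hu, hmax⟩ := exists_max_image Dᶜ d hDc
  have hju : 2 * d u ≤ L := by
    simpa [hD] using hu
  set H : Finset V := univ.filter fun v => L - d u < d v with hH
  have hHD : H ⊆ D := by
    intro v hv
    simp only [hH, hD, mem_filter, mem_univ, true_and] at hv ⊢
    linarith
  have hHj : (#H : ℝ) ≤ d u := by
    refine card_le_sum_adjInd fun v hv => ?_
    simp only [hH, mem_filter, mem_univ, true_and] at hv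
    by_contra hadj
    have hvu : v ≠ u := by
      rintro rfl; linarith
    linarith [hcl v u hvu hadj]
  have hDn : (#D : ℝ) ≤ n := by
    rw [hn]; exact_mod_cast card_le_univ D
  have hHD' : (#H : ℝ) ≤ #D := by exact_mod_cast card_le_card hHD
  -- A vertex `w` of `D` outside `H` has degree at most `L - d u` and is adjacent to the rest of the
  -- clique; the `+ 1` counts `w` itself, and the final term `+ L` of the bound pays for it.
  have hcase : (#D : ℝ) = #H ∨ (#D : ℝ) ≤ L - d u + 1 := by
    by_cases hDH : D ⊆ H
    · left; rw [hDH.antisymm hHD]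
    · right
      obtain ⟨w, hwD, hwH⟩ := not_subset.1 hDH
      have hw : d w ≤ L - d u := by
        simpa [hH] using hwH
      have h1 : (#(D.erase w) : ℝ) ≤ d w := by
        refine card_le_sum_adjInd fun v hv => ?_
        obtain ⟨hvw, hvD⟩ := mem_erase.1 hv
        by_contra hadj
        have := hcl v w hvw hadj
        simp only [hD, mem_filter, mem_univ, true_and] at hvD hwD
        simp only [hd] at hvD hwD
        linarith
      rw [card_erase_of_mem hwD, Nat.cast_sub (card_pos.2 ⟨w, hwD⟩)] at h1
      push_cast at h1
      linarith
  have hsum : ∑ v, d v ≤ #H * n + (#D - #H) * (L - d u) + (n - #D) * d u := by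
    have e1 : ∑ v, d v = ∑ v ∈ H, d v + ∑ v ∈ D \ H, d v + ∑ v ∈ Dᶜ, d v := by
      rw [← sum_add_sum_compl D, ← sum_sdiff hHD]; ring
    have e2 : ∑ v ∈ H, d v ≤ #H * n := by
      rw [← nsmul_eq_mul]; exact sum_le_card_nsmul _ _ _ fun v _ => hdn v
    have e3 : ∑ v ∈ D \ H, d v ≤ (#D - #H) * (L - d u) := by
      have : ((#(D \ H) : ℕ) : ℝ) = #D - #H := by
        rw [card_sdiff_of_subset hHD, Nat.cast_sub (card_le_card hHD)]
      rw [← this, ← nsmul_eq_mul]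
      refine sum_le_card_nsmul _ _ _ fun v hv => ?_
      simpa [hH] using (mem_sdiff.1 hv).2
    have e4 : ∑ v ∈ Dᶜ, d v ≤ (n - #D) * d u := by
      have : ((#(Dᶜ) : ℕ) : ℝ) = n - #D := by
        rw [card_compl, Nat.cast_sub (card_le_univ D)]
      rw [← this, ← nsmul_eq_mul]
      exact sum_le_card_nsmul _ _ _ hmax
    linarith
  refine hsum.trans ?_
  generalize (#H : ℝ) = h at *
  generalize (#D : ℝ) = δ at *
  have hj0 := hd0 u
  generalize d u = j at *
  have hjL : j ≤ n := by linarith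
  rcases hcase with rfl | hδ
  · nlinarith [mul_nonneg (sub_nonneg.2 hHj) (sub_nonneg.2 hjL),
      mul_nonneg (sub_nonneg.2 hju) (show (0 : ℝ) ≤ 2 * n - L / 2 - j by linarith)]
  · nlinarith [mul_nonneg (sub_nonneg.2 hHj) (show (0 : ℝ) ≤ n - L + j by linarith),
      mul_nonneg (sub_nonneg.2 hδ) (show (0 : ℝ) ≤ L - 2 * j by linarith),
      mul_nonneg (show (0 : ℝ) ≤ L - 2 * j by linarith)
        (show (0 : ℝ) ≤ 2 * n - L - 3 * (L / 2 - j) by linarith)]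

lemma exists_isFullList (V : Type*) [Fintype V] : ∃ l : List V, IsFullList l :=
  ⟨univ.toList, Finset.nodup_toList _, fun v => by simp⟩

lemma IsFullList.length_eq {l : List V} (h : IsFullList l) : l.length = Fintype.card V := by
  classical
  rw [← List.toFinset_card_of_nodup h.1, ← card_univ]
  congr 1
  ext v; simp [h.2 v]

lemma card_sub_one_le_consecSum_of_complete (hG : ∀ u v, u ≠ v → G.Adj u v) {l : List V}
    (hl : IsFullList l) : (Fintype.card V : ℝ) - 1 ≤ consecSum (adjInd G) l := by
  have h1 : consecSum (fun _ _ => (1 : ℝ) + 0) l ≤ consecSum (adjInd G) l := by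
    refine consecSum_le_consecSum fun p x y q hs => ?_
    have hnd := hl.1
    rw [hs] at hnd
    have hxy : x ≠ y := by
      rintro rfl
      have := (List.nodup_append.1 hnd).2.1
      simp at this
    rw [adjInd_of_adj (hG x y hxy)]; norm_num
  refine le_trans ?_ h1
  rw [← hl.length_eq]
  cases l with
  | nil => simp [consecSum]
  | cons a t =>
    rw [consecSum_add (fun _ => 1) (fun _ => 0)]
    simp

/-- A graph with half of all edges has at least `(2 - √2) n - 3` edges on some Hamiltonian cycle of
the complete graph. -/
theorem exists_cycleSum_ge (hcard : 3 ≤ Fintype.card V)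
    (hsum : ∑ a, ∑ b, adjInd G a b = (Fintype.card V : ℝ) * ((Fintype.card V : ℝ) - 1) / 2) :
    ∃ l : List V, IsFullList l ∧
      (2 - Real.sqrt 2) * (Fintype.card V : ℝ) - 3 ≤ cycleSum (adjInd G) l := by
  by_contra! hcon
  set n : ℝ := (Fintype.card V : ℝ) with hn
  have hn3 : (3 : ℝ) ≤ n := by rw [hn]; exact_mod_cast hcard
  have hs2 : Real.sqrt 2 ^ 2 = 2 := Real.sq_sqrt (by norm_num)
  have hs0 : 1.41 < Real.sqrt 2 := Real.lt_sqrt_of_sq_lt (by norm_num)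
  set X : ℝ := (2 - Real.sqrt 2) * n - 3 with hX
  obtain ⟨l₀, hl₀⟩ := exists_isFullList V
  have hX0 : 0 ≤ X := (consecSum_nonneg adjInd_nonneg _).trans (hcon l₀ hl₀).le
  have hLX : (⌊X⌋₊ : ℝ) ≤ X := Nat.floor_le hX0
  -- Edge counts are integers, so the bound `X` may be rounded down.
  obtain ⟨G', hGG', hmax⟩ := Finite.exists_le_maximal
    (p := fun H : SimpleGraph V => ∀ l, IsFullList l → cycleSum (adjInd H) l ≤ (⌊X⌋₊ : ℕ))
    (a := G) (by
      intro l hl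
      obtain ⟨k, hk⟩ := exists_nat_eq_consecSum G (l ++ l.head?.toList)
      have := hcon l hl
      rw [cycleSum, hk] at *
      exact_mod_cast Nat.le_floor this.le)
  have hne : ∃ u v, u ≠ v ∧ ¬ G'.Adj u v := by
    by_contra! hcomp
    have h1 := card_sub_one_le_consecSum_of_complete hcomp hl₀
    have h2 := consecSum_le_append (f := adjInd G') adjInd_nonneg l₀ l₀.head?.toList
    have h3 := hmax.1 l₀ hl₀
    rw [cycleSum] at h3
    nlinarith
  have h1 := sum_degree_le_of_closed (L := (⌊X⌋₊ : ℕ))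
    (fun u v huv hadj => degree_sum_le_of_maximal hcard hmax huv hadj) hne
    (by rw [← hn]; nlinarith)
  have h2 : n * (n - 1) / 2 ≤ ∑ v, ∑ x, adjInd G' x v := by
    rw [← hsum, sum_comm]
    exact sum_le_sum fun _ _ => sum_le_sum fun _ _ => adjInd_mono hGG' _ _
  rw [← hn] at h1
  have hL0 : (0 : ℝ) ≤ (⌊X⌋₊ : ℕ) := Nat.cast_nonneg _
  generalize ((⌊X⌋₊ : ℕ) : ℝ) = L at *
  -- The bound increases with `L` in this range. At `X` its leading term is n²/2, and its linear
  -- coefficient 2 - 5√2/2 is below -1/2, which gives the contradiction.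
  have h3 : n * L - L ^ 2 / 4 + L ≤ n * X - X ^ 2 / 4 + X := by
    nlinarith [mul_nonneg (sub_nonneg.2 hLX) (show (0 : ℝ) ≤ n - (X + L) / 4 + 1 by nlinarith)]
  have h4 : n * X - X ^ 2 / 4 + X
      = n ^ 2 / 2 + n * (2 - 5 / 2 * Real.sqrt 2) - 21 / 4 := by
    rw [hX]
    linear_combination (-(n ^ 2) / 4) * hs2
  nlinarith

end DegreeSum

/-! ### From cyclic orders to Hamiltonian cycles -/

section HamiltonianCycle

lemma consecSum_support {V : Type*} (G : SimpleGraph V) [DecidablePred (· ∈ G.edgeSet)]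
    {H : SimpleGraph V} {u v : V}    (p : H.Walk u v) :
    consecSum (adjInd G) p.support
      = ((p.edges.filter (· ∈ G.edgeSet)).length : ℝ) := by
  induction p with
  | nil => simp [consecSum]
  | @cons a b c h p ih =>
    rw [Walk.support_cons, ← Walk.cons_tail_support p, consecSum, Walk.cons_tail_support p, ih,
      Walk.edges_cons]
    by_cases hab : G.Adj a b
    · rw [adjInd_of_adj hab, List.filter_cons_of_pos (by simpa using hab), List.length_cons]
      push_cast; ring
    · rw [adjInd_of_not_adj hab, List.filter_cons_of_neg (by simpa using hab)]
      ring

lemma exists_walk_support_eq {V : Type*} {H : SimpleGraph V} {l : List V} {a b : V} (hne : l ≠ [])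
    (hc : l.IsChain H.Adj) (ha : l.head hne = a) (hb : l.getLast hne = b) :
    ∃ p : H.Walk a b, p.support = l := by
  subst ha hb
  exact ⟨Walk.ofSupport l hne hc, Walk.support_ofSupport hne hc⟩

lemma exists_isHamiltonianCycle_support {n : ℕ} (hn : 3 ≤ n) {h : Fin n} {t : List (Fin n)}
    (hl : IsFullList (h :: t)) :
    ∃ C : (⊤ : SimpleGraph (Fin n)).Walk h h, C.IsHamiltonianCycle ∧
      C.support = h :: t ++ [h] := by
  have hlen : (h :: t).length = n := by rw [hl.length_eq, Fintype.card_fin]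
  have hnd := List.nodup_cons.1 hl.1
  have hchain : (h :: t ++ [h]).IsChain (⊤ : SimpleGraph (Fin n)).Adj := by
    rw [List.isChain_append]
    refine ⟨List.Pairwise.isChain (hl.1.imp fun h => by simpa using h), by simp, ?_⟩
    intro x hx y hy
    have hy' : h = y := by simpa using hy
    subst hy'
    rw [top_adj]
    rintro rfl
    cases t with
    | nil => simp at hlen; omega
    | cons a t =>
      rw [List.getLast?_cons_cons] at hx
      exact hnd.1 (List.mem_of_getLast? hx)
  obtain ⟨C, hs⟩ := exists_walk_support_eq (a := h) (b := h) (by simp) hchain (by simp) (by simp)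
  refine ⟨C, ?_, hs⟩
  have hCl : C.length = n := by
    have := C.length_support
    rw [hs, List.length_append, hlen] at this
    simpa using this.symm
  rw [Walk.isHamiltonianCycle_iff_isCycle_and_length_eq, Fintype.card_fin]
  refine ⟨Walk.isCycle_iff_isPath_tail_and_le_length.2 ⟨?_, by omega⟩, hCl⟩
  refine Walk.IsPath.mk' ?_
  rw [Walk.support_tail_of_not_nil, hs]
  · simp only [List.cons_append, List.tail_cons]
    exact (List.perm_append_singleton h t).nodup_iff.2 hl.1
  · intro hnil
    have := Walk.length_eq_zero_iff.2 hnil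
    omega

/-- The labelled edges along a cyclic order of all vertices are edges of a Hamiltonian cycle. -/
theorem exists_isHamiltonianCycle_plusCount_ge {n : ℕ} (hn : 3 ≤ n)
    (c : TopEdgeLabeling (Fin n) ℤˣ) {l : List (Fin n)} (hl : IsFullList l) :
    ∃ (v : Fin n) (C : (⊤ : SimpleGraph (Fin n)).Walk v v), C.IsHamiltonianCycle ∧
      cycleSum (adjInd (c.labelGraph 1)) l ≤ (plusCount c C.toSubgraph.spanningCoe : ℝ) := by
  classical
  cases l with
  | nil => exact absurd (hl.2 ⟨0, by omega⟩) (by simp)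
  | cons h t =>
    obtain ⟨C, hC, hs⟩ := exists_isHamiltonianCycle_support hn hl
    refine ⟨h, C, hC, ?_⟩
    rw [cycleSum, List.head?_cons, Option.toList_some, ← hs, consecSum_support, plusCount,
      labelCount_eq_ncard]
    -- A cycle repeats no edge, so the count along the list is the count of the edge set.
    have hnd : (C.edges.filter (· ∈ (c.labelGraph 1).edgeSet)).Nodup :=
      hC.isCycle.edges_nodup.filter _
    rw [← List.toFinset_card_of_nodup hnd, ← Set.ncard_coe_finset]
    refine le_of_eq (congrArg _ (congrArg _ ?_))
    ext e
    simp only [List.coe_toFinset, List.mem_filter, decide_eq_true_eq, Set.mem_ofPred_eq,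
      Set.mem_inter_iff, Subgraph.edgeSet_spanningCoe, Walk.mem_edges_toSubgraph]

end HamiltonianCycle

/-! ### Disjoint triples and triangle factors -/

/-- The number of edges of `G` among three vertices. -/
noncomputable def triangleWeight {V : Type*} (G : SimpleGraph V) (a b c : V) : ℝ :=
  adjInd G a b + adjInd G b c + adjInd G a c

/-- `TriangleTiling G S w`: the set `S` is a disjoint union of triples that contain `w` edges
of `G` in total. -/
inductive TriangleTiling {V : Type*} [DecidableEq V] (G : SimpleGraph V) : Finset V → ℝ → Prop
  | empty : TriangleTiling G ∅ 0
  | insert {a b c : V} {S : Finset V} {w : ℝ} (hab : a ≠ b) (hbc : b ≠ c) (hac : a ≠ c)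
      (ha : a ∉ S) (hb : b ∉ S) (hc : c ∉ S) (h : TriangleTiling G S w) :
      TriangleTiling G ({a, b, c} ∪ S) (triangleWeight G a b c + w)

lemma triangleWeight_nonneg {V : Type*} {G : SimpleGraph V} (a b c : V) :
    0 ≤ triangleWeight G a b c :=
  add_nonneg (add_nonneg (adjInd_nonneg _ _) (adjInd_nonneg _ _)) (adjInd_nonneg _ _)

section Tiling

variable {V : Type*} [DecidableEq V] {G : SimpleGraph V}

lemma TriangleTiling.nonneg {S : Finset V} {w : ℝ} (h : TriangleTiling G S w) : 0 ≤ w := by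
  induction h with
  | empty => exact le_rfl
  | insert _ _ _ _ _ _ _ ih => exact add_nonneg (triangleWeight_nonneg _ _ _) ih

lemma TriangleTiling.three_dvd_card {S : Finset V} {w : ℝ} (h : TriangleTiling G S w) :
    3 ∣ #S := by
  induction h with
  | empty => simp
  | @insert a b c S w hab hbc hac ha hb hc h ih =>
    rw [card_union_of_disjoint (by simp [ha, hb, hc]), card_eq_three.2 ⟨a, b, c, hab, hac, hbc, rfl⟩]
    exact dvd_add (dvd_refl 3) ih

lemma TriangleTiling.union {S T : Finset V} {w v : ℝ} (hS : TriangleTiling G S w)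
    (hT : TriangleTiling G T v) (hd : Disjoint S T) : TriangleTiling G (S ∪ T) (w + v) := by
  induction hS with
  | empty => simpa using hT
  | @insert a b c S w hab hbc hac ha hb hc h ih =>
    rw [disjoint_union_left] at hd
    have h1 := hd.1
    simp only [disjoint_insert_left, disjoint_singleton_left] at h1
    rw [union_assoc, add_assoc]
    refine .insert hab hbc hac ?_ ?_ ?_ (ih hd.2) <;> rw [mem_union, not_or]
    · exact ⟨ha, h1.1⟩
    · exact ⟨hb, h1.2.1⟩
    · exact ⟨hc, h1.2.2⟩

lemma exists_triangleTiling (G : SimpleGraph V) (t : ℕ) {S : Finset V} (hS : #S = 3 * t) :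
    ∃ w, TriangleTiling G S w := by
  induction t generalizing S with
  | zero =>
    rw [mul_zero, card_eq_zero] at hS
    exact ⟨0, hS ▸ .empty⟩
  | succ t ih =>
    obtain ⟨T, hTS, hT⟩ := exists_subset_card_eq (show 3 ≤ #S by omega)
    obtain ⟨w, hw⟩ := ih (S := S \ T) (by rw [card_sdiff_of_subset hTS]; omega)
    obtain ⟨a, b, c, hab, hac, hbc, rfl⟩ := card_eq_three.1 hT
    have := TriangleTiling.insert (G := G) hab hbc hac (by simp) (by simp) (by simp) hw
    rw [union_sdiff_of_subset hTS] at this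
    exact ⟨_, this⟩

lemma triangleTiling_biUnion {ι : Type*} [DecidableEq ι] (s : Finset ι) {x y z : ι → V}
    (hx : x.Injective) (hy : y.Injective) (hz : z.Injective) (hxy : ∀ i j, x i ≠ y j)
    (hyz : ∀ i j, y i ≠ z j) (hxz : ∀ i j, x i ≠ z j) :
    TriangleTiling G (s.biUnion fun i => {x i, y i, z i})
      (∑ i ∈ s, triangleWeight G (x i) (y i) (z i)) := by
  induction s using Finset.induction_on with
  | empty => simpa using TriangleTiling.empty
  | insert i s hi ih =>
    rw [biUnion_insert, sum_insert hi]
    refine .insert (hxy i i) (hyz i i) (hxz i i) ?_ ?_ ?_ ih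
    · simp only [mem_biUnion, mem_insert, mem_singleton, not_exists, not_and, not_or]
      exact fun j hj => ⟨fun h => hi (hx h ▸ hj), hxy i j, hxz i j⟩
    · simp only [mem_biUnion, mem_insert, mem_singleton, not_exists, not_and, not_or]
      exact fun j hj => ⟨(hxy j i).symm, fun h => hi (hy h ▸ hj), hyz i j⟩
    · simp only [mem_biUnion, mem_insert, mem_singleton, not_exists, not_and, not_or]
      exact fun j hj => ⟨(hxz j i).symm, (hyz j i).symm, fun h => hi (hz h ▸ hj)⟩

/-- Some disjoint triples inside `A` contain at least `w` edges of `G` in total. -/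
def HasPartialTiling (G : SimpleGraph V) (A : Finset V) (w : ℝ) : Prop :=
  ∃ S ⊆ A, ∃ v, w ≤ v ∧ TriangleTiling G S v

lemma HasPartialTiling.mono {A B : Finset V} {w v : ℝ} (h : HasPartialTiling G A w) (hAB : A ⊆ B)
    (hv : v ≤ w) : HasPartialTiling G B v := by
  obtain ⟨S, hS, u, hu, h⟩ := h
  exact ⟨S, hS.trans hAB, u, hv.trans hu, h⟩

lemma HasPartialTiling.union {A B : Finset V} {w v : ℝ} (hA : HasPartialTiling G A w)
    (hB : HasPartialTiling G B v) (hd : Disjoint A B) : HasPartialTiling G (A ∪ B) (w + v) := by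
  obtain ⟨S, hS, u, hu, h⟩ := hA
  obtain ⟨S', hS', u', hu', h'⟩ := hB
  exact ⟨S ∪ S', union_subset_union hS hS', u + u', add_le_add hu hu',
    h.union h' (hd.mono hS hS')⟩

lemma hasPartialTiling_of_nonpos {A : Finset V} {w : ℝ} (h : w ≤ 0) : HasPartialTiling G A w :=
  ⟨∅, empty_subset _, 0, h, .empty⟩

/-- The number of uncovered vertices is a multiple of three; grouping them arbitrarily loses
nothing. -/
lemma HasPartialTiling.exists_univ [Fintype V] {A : Finset V} {w : ℝ}
    (h : HasPartialTiling G A w) (h3 : 3 ∣ Fintype.card V) :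
    ∃ v, w ≤ v ∧ TriangleTiling G univ v := by
  obtain ⟨S, -, u, hu, h⟩ := h
  obtain ⟨t, ht⟩ : 3 ∣ #(Sᶜ) := by
    rw [card_compl]
    exact Nat.dvd_sub h3 h.three_dvd_card
  obtain ⟨v, hv⟩ := exists_triangleTiling G t ht
  have := h.union hv disjoint_compl_right
  rw [union_compl] at this
  exact ⟨u + v, by linarith [hv.nonneg], this⟩

lemma ncard_triangle_inter_edgeSet {a b c : V} (hab : a ≠ b) (hbc : b ≠ c) (hac : a ≠ c) :
    ((({s(a, b), s(b, c), s(a, c)} : Set (Sym2 V)) ∩ G.edgeSet).ncard : ℝ)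
      = triangleWeight G a b c := by
  classical
  have e : ({s(a, b), s(b, c), s(a, c)} : Set (Sym2 V)) ∩ G.edgeSet
      = ((({s(a, b), s(b, c), s(a, c)} : Finset (Sym2 V)).filter (· ∈ G.edgeSet) :
          Finset (Sym2 V)) : Set (Sym2 V)) := by
    ext e; simp
  rw [e, Set.ncard_coe_finset, card_filter, sum_insert, sum_insert, sum_singleton]
  · simp only [mem_edgeSet, triangleWeight, adjInd]
    push_cast; ring
  · simp [hab.symm, hbc]
  · simp
    grind

/-- The triangles of a tiling form a graph. -/
lemma TriangleTiling.exists_graph [Finite V] {S : Finset V} {w : ℝ} (h : TriangleTiling G S w) :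
    ∃ F : SimpleGraph V, (∀ a b, F.Adj a b → a ∈ S) ∧
      (∀ a ∈ S, ∃ b c, a ≠ b ∧ b ≠ c ∧ a ≠ c ∧ F.Adj b c ∧ ∀ d, F.Adj a d ↔ d = b ∨ d = c) ∧
      ((F.edgeSet ∩ G.edgeSet).ncard : ℝ) = w := by
  induction h with
  | empty => exact ⟨⊥, by simp, by simp, by simp⟩
  | @insert a b c S w hab hbc hac ha hb hc h ih =>
    obtain ⟨F, hFS, hF, hcard⟩ := ih
    set T : SimpleGraph V := fromEdgeSet {s(a, b), s(b, c), s(a, c)} with hT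
    have hTadj : ∀ x y, T.Adj x y ↔ x ≠ y ∧ (x = a ∨ x = b ∨ x = c) ∧ (y = a ∨ y = b ∨ y = c) := by
      intro x y
      simp only [hT, fromEdgeSet_adj, Set.mem_insert_iff, Set.mem_singleton_iff, Sym2.eq_iff]
      grind
    have hFS' : ∀ x y, F.Adj x y → y ∈ S := fun x y h => hFS y x h.symm
    refine ⟨F ⊔ T, ?_, ?_, ?_⟩
    · intro x y hxy
      rw [sup_adj] at hxy
      rcases hxy with hxy | hxy
      · exact mem_union_right _ (hFS x y hxy)
      · have := ((hTadj x y).1 hxy).2.1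
        simp only [mem_union, mem_insert, mem_singleton]
        exact Or.inl this
    · intro x hx
      have hnot : ∀ d ∈ S, d ≠ a ∧ d ≠ b ∧ d ≠ c := by grind
      have hadj : ∀ x ∈ ({a, b, c} : Finset V), ∀ d, (F ⊔ T).Adj x d ↔
          x ≠ d ∧ (d = a ∨ d = b ∨ d = c) := by
        intro x hx d
        rw [sup_adj, hTadj]
        have : ¬ F.Adj x d := fun h => by
          have := hFS x d h
          grind
        grind
      rcases mem_union.1 hx with hx | hx
      · have hx' := hx
        simp only [mem_insert, mem_singleton] at hx
        rcases hx with rfl | rfl | rfl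
        · exact ⟨b, c, hab, hbc, hac, by rw [hadj b (by simp)]; grind, fun d => by
            rw [hadj _ hx']; grind⟩
        · exact ⟨a, c, hab.symm, hac, hbc, by rw [hadj a (by simp)]; grind, fun d => by
            rw [hadj _ hx']; grind⟩
        · exact ⟨a, b, hac.symm, hab, hbc.symm, by rw [hadj a (by simp)]; grind, fun d => by
            rw [hadj _ hx']; grind⟩
      · obtain ⟨y, z, h1, h2, h3, h4, h5⟩ := hF x hx
        refine ⟨y, z, h1, h2, h3, Or.inl h4, fun d => ?_⟩
        rw [sup_adj, h5, hTadj]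
        have := hnot x hx
        grind
    · have hTe : T.edgeSet = {s(a, b), s(b, c), s(a, c)} := by
        rw [hT, edgeSet_fromEdgeSet, sdiff_eq_left]
        rw [Set.disjoint_left]
        rintro e he
        simp only [Set.mem_insert_iff, Set.mem_singleton_iff] at he
        rcases he with rfl | rfl | rfl <;> simpa
      rw [edgeSet_sup, Set.union_inter_distrib_right, Set.ncard_union_eq, Nat.cast_add, hcard, hTe,
        ncard_triangle_inter_edgeSet hab hbc hac, add_comm]
      rw [Set.disjoint_left]
      rintro e ⟨h1, -⟩ ⟨h2, -⟩
      induction e using Sym2.inductionOn with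
      | hf x y =>
        have := hFS x y h1
        have := (hTadj x y).1 h2
        grind

/-- The hypothesis at `b` and `c` makes `{a, b, c}` closed under adjacency, so it is the whole
component of `a`. -/
lemma isTriangleFactor_of_forall {F : SimpleGraph V}
    (hF : ∀ a, ∃ b c, a ≠ b ∧ b ≠ c ∧ a ≠ c ∧ F.Adj b c ∧ ∀ d, F.Adj a d ↔ d = b ∨ d = c) :
    IsTriangleFactor F := by
  intro C
  induction C using ConnectedComponent.ind with
  | h a =>
    obtain ⟨b, c, hab, hbc, hac, hadj, h⟩ := hF a
    have hFab : F.Adj a b := (h b).2 (Or.inl rfl)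
    have hFac : F.Adj a c := (h c).2 (Or.inr rfl)
    have hclosed : ∀ x y, F.Adj x y → x ∈ ({a, b, c} : Finset V) → y ∈ ({a, b, c} : Finset V) := by
      intro x y hxy hx
      obtain ⟨b', c', h1, h2, h3, h4, h5⟩ := hF x
      simp only [mem_insert, mem_singleton] at hx ⊢
      rcases hx with rfl | rfl | rfl
      · have := (h y).1 hxy; tauto
      · have e1 := (h5 a).1 hFab.symm
        have e2 := (h5 c).1 hadj
        have e3 := (h5 y).1 hxy
        grind
      · have e1 := (h5 a).1 hFac.symm
        have e2 := (h5 b).1 hadj.symm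
        have e3 := (h5 y).1 hxy
        grind
    have hwalk : ∀ x y, F.Reachable x y → x ∈ ({a, b, c} : Finset V) →
        y ∈ ({a, b, c} : Finset V) := by
      rintro x y ⟨p⟩
      induction p with
      | nil => exact id
      | cons hxy p ih => exact fun hx => ih (hclosed _ _ hxy hx)
    have hsupp : ∀ x, x ∈ (F.connectedComponentMk a).supp ↔ x ∈ ({a, b, c} : Finset V) := by
      intro x
      rw [ConnectedComponent.mem_supp_iff, ConnectedComponent.eq]
      constructor
      · exact fun hx => hwalk a x hx.symm (by simp)
      · intro hx
        simp only [mem_insert, mem_singleton] at hx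
        rcases hx with rfl | rfl | rfl
        · exact Reachable.refl _
        · exact hFab.symm.reachable
        · exact hFac.symm.reachable
    have htop : (F.connectedComponentMk a).toSimpleGraph = ⊤ := by
      ext ⟨x, hx⟩ ⟨y, hy⟩
      have hx' := (hsupp x).1 hx
      have hy' := (hsupp y).1 hy
      simp only [mem_insert, mem_singleton] at hx' hy'
      have hba := hFab.symm
      have hca := hFac.symm
      have hcb := hadj.symm
      have : F.Adj x y ↔ x ≠ y := by
        constructor
        · exact fun h => h.ne
        · grind
      simpa [ConnectedComponent.toSimpleGraph] using this
    rw [htop, cycleGraph_three_eq_top]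
    have e1 : {x // x ∈ F.connectedComponentMk a} ≃ {x // x ∈ ({a, b, c} : Finset V)} :=
      Equiv.subtypeEquivRight hsupp
    have e2 : {x // x ∈ ({a, b, c} : Finset V)} ≃ Fin 3 :=
      Finset.equivFinOfCardEq (card_eq_three.2 ⟨a, b, c, hab, hac, hbc, rfl⟩)
    exact ⟨Iso.completeGraph (e1.trans e2)⟩

end Tiling

lemma HasPartialTiling.exists_isTriangleFactor {n : ℕ} (h3 : 3 ∣ n)
    {c : TopEdgeLabeling (Fin n) ℤˣ} {A : Finset (Fin n)} {w : ℝ}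
    (h : HasPartialTiling (c.labelGraph 1) A w) :
    ∃ F : SimpleGraph (Fin n), IsTriangleFactor F ∧ w ≤ (plusCount c F : ℝ) := by
  obtain ⟨v, hv, ht⟩ := h.exists_univ (by rwa [Fintype.card_fin])
  obtain ⟨F, -, hF, hcard⟩ := ht.exists_graph
  refine ⟨F, isTriangleFactor_of_forall fun a => hF a (mem_univ a), ?_⟩
  rwa [plusCount, labelCount_eq_ncard, hcard]

/-! ### Averaging over permutations -/

section PermAverage

lemma exists_perm_apply_eq {κ : Type*} [DecidableEq κ] {i j i' j' : κ} (hij : i ≠ j) (hij' : i' ≠ j') :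
    ∃ σ : Equiv.Perm κ, σ i = i' ∧ σ j = j' := by
  refine ⟨(Equiv.swap i i').trans (Equiv.swap (Equiv.swap i i' j) j'), ?_, ?_⟩
  · rw [Equiv.trans_apply, Equiv.swap_apply_left, Equiv.swap_apply_of_ne_of_ne _ hij']
    intro h
    have := congrArg (Equiv.swap i i') h
    rw [Equiv.swap_apply_right, Equiv.swap_apply_self] at this
    exact hij this
  · rw [Equiv.trans_apply, Equiv.swap_apply_left]

variable {κ : Type*} [Fintype κ] [DecidableEq κ]

lemma sum_perm_apply_eq (f : κ → κ → ℝ) {i j i' j' : κ} (hij : i ≠ j) (hij' : i' ≠ j') :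
    ∑ π : Equiv.Perm κ, f (π i) (π j) = ∑ π : Equiv.Perm κ, f (π i') (π j') := by
  obtain ⟨σ, h1, h2⟩ := exists_perm_apply_eq hij hij'
  refine (Fintype.sum_equiv (Equiv.mulRight σ) _ _ fun π => ?_).symm
  simp [h1, h2]

/-- Permutations act transitively on ordered pairs of distinct elements, so a random one sends `(i,
j)` to a uniform such pair. -/
lemma card_offDiag_mul_sum_perm (f : κ → κ → ℝ) {i j : κ} (hij : i ≠ j) :
    (#(univ : Finset κ).offDiag : ℝ) * ∑ π : Equiv.Perm κ, f (π i) (π j)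
      = (Fintype.card (Equiv.Perm κ) : ℝ) * ∑ p ∈ (univ : Finset κ).offDiag, f p.1 p.2 := by
  have h1 : ∑ p ∈ (univ : Finset κ).offDiag, ∑ π : Equiv.Perm κ, f (π p.1) (π p.2)
      = (#(univ : Finset κ).offDiag : ℝ) * ∑ π : Equiv.Perm κ, f (π i) (π j) := by
    rw [← nsmul_eq_mul, ← sum_const]
    refine sum_congr rfl fun p hp => sum_perm_apply_eq f ?_ hij
    simpa using hp
  rw [← h1, sum_comm, ← card_univ, ← nsmul_eq_mul, ← sum_const]
  refine sum_congr rfl fun π _ => ?_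
  refine sum_bij' (fun p _ => (π p.1, π p.2)) (fun p _ => (π.symm p.1, π.symm p.2)) ?_ ?_ ?_ ?_ ?_
  all_goals simp

/-- Some permutation does at least as well as the average one. -/
lemma exists_perm_sum_ge {ι : Type*} [Fintype ι] (f : ι → κ → κ → ℝ) (p q : ι → κ)
    (hpq : ∀ i, p i ≠ q i) :
    ∃ π : Equiv.Perm κ, ∑ i, ∑ r ∈ (univ : Finset κ).offDiag, f i r.1 r.2
      ≤ (#(univ : Finset κ).offDiag : ℝ) * ∑ i, f i (π (p i)) (π (q i)) := by
  obtain ⟨π, -, hπ⟩ := exists_le_of_sum_le (s := (univ : Finset (Equiv.Perm κ)))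
    (f := fun _ => ∑ i, ∑ r ∈ (univ : Finset κ).offDiag, f i r.1 r.2)
    (g := fun π => (#(univ : Finset κ).offDiag : ℝ) * ∑ i, f i (π (p i)) (π (q i)))
    univ_nonempty (by
      have e : ∑ π : Equiv.Perm κ, (#(univ : Finset κ).offDiag : ℝ) * ∑ i, f i (π (p i)) (π (q i))
          = ∑ i, (#(univ : Finset κ).offDiag : ℝ)
            * ∑ π : Equiv.Perm κ, f i (π (p i)) (π (q i)) := by
        rw [← mul_sum, sum_comm, mul_sum]
      rw [e, sum_const, nsmul_eq_mul, card_univ, mul_sum]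
      exact (sum_congr rfl fun i _ => card_offDiag_mul_sum_perm (f i) (hpq i)).ge)
  exact ⟨π, hπ⟩

lemma sum_offDiag_eq (f : κ → κ → ℝ) :
    ∑ r ∈ (univ : Finset κ).offDiag, f r.1 r.2 = ∑ k, ∑ l, f k l - ∑ k, f k k := by
  rw [← sum_product', univ_product_univ, ← univ_product_univ, ← diag_union_offDiag,
    sum_union (disjoint_diag_offDiag _), sum_diag]
  ring

lemma card_offDiag_univ_fin (t : ℕ) :
    (#(univ : Finset (Fin t × Fin 3)).offDiag : ℝ) = 3 * t * (3 * t - 1) := by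
  rw [offDiag_card, Nat.cast_sub (Nat.le_mul_self _)]
  simp only [card_univ, Fintype.card_prod, Fintype.card_fin]
  push_cast; ring

end PermAverage

/-! ### Random triples -/

section RandomTriples

variable {V : Type*} [DecidableEq V] {G : SimpleGraph V}

/-- Regroup matching edges in threes and split every third edge between the other two. -/
lemma hasPartialTiling_of_blocks {t : ℕ} {x y : Fin t × Fin 3 → V} (hx : x.Injective)
    (hy : y.Injective) (hxy : ∀ i j, x i ≠ y j) (hadj : ∀ i, G.Adj (x i) (y i)) (ht : 0 < t) :
    HasPartialTiling G (univ.image x ∪ univ.image y)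
      (2 * t + (∑ k, ∑ l, (adjInd G (x k) (x l) + adjInd G (x k) (y l) + adjInd G (y k) (x l)
        + adjInd G (y k) (y l)) - 6 * t) / (9 * t)) := by
  set E : ℝ := ∑ k, ∑ l, (adjInd G (x k) (x l) + adjInd G (x k) (y l) + adjInd G (y k) (x l)
        + adjInd G (y k) (y l)) with hE
  -- `f e k l` counts the edges between matching edge `k` and the endpoint of edge `l` handed to it:
  -- `x l` for `e = 0`, `y l` for `e = 1`.
  set f : Fin 2 → Fin t × Fin 3 → Fin t × Fin 3 → ℝ := fun e k l =>
    if e = 0 then adjInd G (y k) (x l) + adjInd G (x k) (x l)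
      else adjInd G (y k) (y l) + adjInd G (x k) (y l) with hf
  obtain ⟨π, hπ⟩ := exists_perm_sum_ge (ι := Fin t × Fin 2) (fun i => f i.2)
    (fun i => (i.1, i.2.castSucc)) (fun i => (i.1, 2)) (by
      rintro ⟨j, e⟩ h
      have := congrArg (fun p => (p.2 : Fin 3).val) h
      simp at this
      omega)
  have hoff : ∑ i : Fin t × Fin 2, ∑ r ∈ (univ : Finset (Fin t × Fin 3)).offDiag, f i.2 r.1 r.2
      = t * (E - 6 * t) := by
    have h1 : ∑ e : Fin 2, ∑ r ∈ (univ : Finset (Fin t × Fin 3)).offDiag, f e r.1 r.2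
        = E - 6 * t := by
      -- The diagonal sees only the matching edges, twice each; over `3 t` edges this is the
      -- correction `6 t`.
      have h2 : ∀ k, ∑ e : Fin 2, f e k k = 2 := by
        intro k
        simp [hf, adjInd_self, adjInd_of_adj (hadj k), adjInd_of_adj (hadj k).symm]
      rw [sum_comm]
      have h3 := sum_offDiag_eq (κ := Fin t × Fin 3) (fun k l => ∑ e : Fin 2, f e k l)
      rw [h3]
      simp only [h2]
      congr 1
      · rw [hE]
        refine sum_congr rfl fun k _ => sum_congr rfl fun l _ => ?_
        simp [hf]; ring
      · simp; ring
    rw [Fintype.sum_prod_type, sum_congr rfl fun j _ => h1]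
    simp only [sum_const, card_univ, Fintype.card_fin, nsmul_eq_mul]
  have hE6 : 0 ≤ E - 6 * t := by
    have h0 : 0 ≤ (t : ℝ) * (E - 6 * t) := by
      rw [← hoff]
      refine sum_nonneg fun i _ => sum_nonneg fun r _ => ?_
      simp only [hf]
      split_ifs <;> exact add_nonneg (adjInd_nonneg _ _) (adjInd_nonneg _ _)
    exact nonneg_of_mul_nonneg_right h0 (by exact_mod_cast ht)
  rw [hoff, card_offDiag_univ_fin, Fintype.sum_prod_type] at hπ
  have inj : ∀ (e e' : Fin 3) (j j' : Fin t), π (j, e) = π (j', e') → j = j' ∧ e = e' := by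
    intro e e' j j' h
    simpa using π.injective h
  have T0 := triangleTiling_biUnion (G := G) (univ : Finset (Fin t)) (x := fun j => x (π (j, 0)))
    (y := fun j => y (π (j, 0))) (z := fun j => x (π (j, 2)))
    (fun i j h => (inj _ _ _ _ (hx h)).1) (fun i j h => (inj _ _ _ _ (hy h)).1)
    (fun i j h => (inj _ _ _ _ (hx h)).1) (fun i j => hxy _ _) (fun i j => (hxy _ _).symm)
    (fun i j h => absurd (inj _ _ _ _ (hx h)).2 (by decide))
  have T1 := triangleTiling_biUnion (G := G) (univ : Finset (Fin t)) (x := fun j => x (π (j, 1)))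
    (y := fun j => y (π (j, 1))) (z := fun j => y (π (j, 2)))
    (fun i j h => (inj _ _ _ _ (hx h)).1) (fun i j h => (inj _ _ _ _ (hy h)).1)
    (fun i j h => (inj _ _ _ _ (hy h)).1) (fun i j => hxy _ _)
    (fun i j h => absurd (inj _ _ _ _ (hy h)).2 (by decide)) (fun i j => hxy _ _)
  have hd : Disjoint
      ((univ : Finset (Fin t)).biUnion fun j => {x (π (j, 0)), y (π (j, 0)), x (π (j, 2))})
      ((univ : Finset (Fin t)).biUnion fun j => {x (π (j, 1)), y (π (j, 1)), y (π (j, 2))}) := by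
    have d01 : ∀ i j : Fin t, x (π (j, 1)) ≠ x (π (i, 0)) := fun i j h =>
      absurd (inj _ _ _ _ (hx h)).2 (by decide)
    have d21 : ∀ i j : Fin t, x (π (j, 1)) ≠ x (π (i, 2)) := fun i j h =>
      absurd (inj _ _ _ _ (hx h)).2 (by decide)
    have e01 : ∀ i j : Fin t, y (π (j, 1)) ≠ y (π (i, 0)) := fun i j h =>
      absurd (inj _ _ _ _ (hy h)).2 (by decide)
    have e02 : ∀ i j : Fin t, y (π (j, 2)) ≠ y (π (i, 0)) := fun i j h =>
      absurd (inj _ _ _ _ (hy h)).2 (by decide)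
    have hyx : ∀ i j, y i ≠ x j := fun i j => (hxy j i).symm
    rw [disjoint_biUnion_left]
    intro i _
    rw [disjoint_biUnion_right]
    intro j _
    simp [d01, d21, e01, e02, hxy, hyx]
  refine ⟨_, ?_, _, ?_, T0.union T1 hd⟩
  · intro v hv
    simp only [mem_union, mem_biUnion, mem_univ, true_and, mem_insert, mem_singleton,
      mem_image] at hv ⊢
    grind
  · have hval : ∑ j : Fin t, triangleWeight G (x (π (j, 0))) (y (π (j, 0))) (x (π (j, 2)))
        + ∑ j : Fin t, triangleWeight G (x (π (j, 1))) (y (π (j, 1))) (y (π (j, 2)))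
        = 2 * t + ∑ j : Fin t, ∑ e : Fin 2, f e (π (j, e.castSucc)) (π (j, 2)) := by
      rw [← sum_add_distrib]
      have : (2 * t : ℝ) = ∑ _j : Fin t, 2 := by simp; ring
      rw [this, ← sum_add_distrib]
      refine sum_congr rfl fun j _ => ?_
      simp [triangleWeight, hf, adjInd_of_adj (hadj _)]
      ring
    rw [hval]
    have ht' : (1 : ℝ) ≤ t := by exact_mod_cast ht
    generalize ∑ j : Fin t, ∑ e : Fin 2, f e (π (j, e.castSucc)) (π (j, 2)) = W at hπ ⊢
    have h1 : E - 6 * t ≤ 3 * (3 * t - 1) * W := by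
      refine le_of_mul_le_mul_left ?_ (show (0 : ℝ) < t by linarith)
      linarith
    have hW : 0 ≤ W := by
      by_contra hneg
      nlinarith
    have : (E - 6 * t) / (9 * t) ≤ W := by
      rw [div_le_iff₀ (by positivity)]
      nlinarith
    linarith

/-- Random grouping of the vertices in threes. The average has denominator `3 t - 1`, weakened to `3
t`. -/
lemma hasPartialTiling_of_injective {t : ℕ} {z : Fin t × Fin 3 → V} (hz : z.Injective)
    (ht : 0 < t) :
    HasPartialTiling G (univ.image z) ((∑ k, ∑ l, adjInd G (z k) (z l)) / (3 * t)) := by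
  set E : ℝ := ∑ k, ∑ l, adjInd G (z k) (z l) with hE
  have hE0 : 0 ≤ E := sum_nonneg fun _ _ => sum_nonneg fun _ _ => adjInd_nonneg _ _
  obtain ⟨π, hπ⟩ := exists_perm_sum_ge (ι := Fin t × Fin 3) (fun _ k l => adjInd G (z k) (z l))
    (fun i => i) (fun i => (i.1, i.2 + 1)) (by
      rintro ⟨j, e⟩ h
      have := congrArg (fun p => (p.2 : Fin 3)) h
      simp at this)
  rw [sum_congr rfl fun i _ => sum_offDiag_eq (fun k l => adjInd G (z k) (z l)),
    card_offDiag_univ_fin] at hπ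
  simp only [adjInd_self, sum_const_zero, sub_zero, ← hE, sum_const, card_univ, Fintype.card_fin,
    Fintype.card_prod, nsmul_eq_mul] at hπ
  rw [Fintype.sum_prod_type] at hπ
  have inj : ∀ (e e' : Fin 3) (j j' : Fin t), π (j, e) = π (j', e') → j = j' ∧ e = e' := by
    intro e e' j j' h
    simpa using π.injective h
  have T0 := triangleTiling_biUnion (G := G) (univ : Finset (Fin t)) (x := fun j => z (π (j, 0)))
    (y := fun j => z (π (j, 1))) (z := fun j => z (π (j, 2)))
    (fun i j h => (inj _ _ _ _ (hz h)).1) (fun i j h => (inj _ _ _ _ (hz h)).1)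
    (fun i j h => (inj _ _ _ _ (hz h)).1)
    (fun i j h => absurd (inj _ _ _ _ (hz h)).2 (by decide))
    (fun i j h => absurd (inj _ _ _ _ (hz h)).2 (by decide))
    (fun i j h => absurd (inj _ _ _ _ (hz h)).2 (by decide))
  refine ⟨_, ?_, _, ?_, T0⟩
  · intro v hv
    simp only [mem_biUnion, mem_univ, true_and, mem_insert, mem_singleton, mem_image] at hv ⊢
    grind
  · have hval : ∑ j : Fin t, triangleWeight G (z (π (j, 0))) (z (π (j, 1))) (z (π (j, 2)))
        = ∑ j : Fin t, ∑ e : Fin 3, adjInd G (z (π (j, e))) (z (π (j, e + 1))) := by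
      refine sum_congr rfl fun j _ => ?_
      rw [Fin.sum_univ_three, triangleWeight, adjInd_comm (z (π (j, 0))) (z (π (j, 2)))]
      rfl
    rw [hval]
    have ht' : (1 : ℝ) ≤ t := by exact_mod_cast ht
    generalize ∑ j : Fin t, ∑ e : Fin 3, adjInd G (z (π (j, e))) (z (π (j, e + 1))) = W at hπ ⊢
    have h1 : E ≤ (3 * t - 1) * W := by
      refine le_of_mul_le_mul_left ?_ (show (0 : ℝ) < 3 * t by linarith)
      push_cast at hπ
      linarith
    have hW : 0 ≤ W := by
      by_contra hneg
      nlinarith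
    rw [div_le_iff₀ (by positivity)]
    nlinarith

/-- Extend matching edges by distinct further vertices. -/
lemma hasPartialTiling_of_edges_of_vertices {s u : ℕ} (hsu : s ≤ u) (hu : 0 < u) {x y : Fin s → V}
    {z : Fin u → V} (hx : x.Injective) (hy : y.Injective) (hz : z.Injective)
    (hxy : ∀ i j, x i ≠ y j) (hyz : ∀ i j, y i ≠ z j) (hxz : ∀ i j, x i ≠ z j)
    (hadj : ∀ i, G.Adj (x i) (y i)) :
    HasPartialTiling G (univ.image x ∪ univ.image y ∪ univ.image z)
      (s + (∑ j, ∑ k, (adjInd G (x j) (z k) + adjInd G (y j) (z k))) / u) := by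
  have : NeZero u := ⟨hu.ne'⟩
  set E : ℝ := ∑ j, ∑ k, (adjInd G (x j) (z k) + adjInd G (y j) (z k)) with hE
  -- Cyclic shifts suffice for the averaging: over the `u` shifts each edge meets each further
  -- vertex exactly once.
  set φ : Fin s → Fin u → Fin u := fun j r => r + Fin.castLE hsu j with hφ
  have hφinj : ∀ r, (fun j => φ j r).Injective := fun r i j h =>
    Fin.castLE_injective hsu (add_left_cancel h)
  obtain ⟨r, -, hr⟩ := exists_le_of_sum_le (s := (univ : Finset (Fin u)))
    (f := fun _ => E / u)
    (g := fun r => ∑ j, (adjInd G (x j) (z (φ j r)) + adjInd G (y j) (z (φ j r))))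
    univ_nonempty (by
      rw [sum_const, card_univ, Fintype.card_fin, nsmul_eq_mul,
        mul_div_cancel₀ _ (by positivity), sum_comm, hE]
      refine (sum_congr rfl fun j _ => ?_).le
      exact (Equiv.sum_comp (Equiv.addRight (Fin.castLE hsu j))
        fun k => adjInd G (x j) (z k) + adjInd G (y j) (z k)).symm)
  refine ⟨_, ?_, _, ?_, triangleTiling_biUnion (G := G) (univ : Finset (Fin s)) (x := x) (y := y)
    (z := fun j => z (φ j r)) hx hy (hz.comp (hφinj r)) hxy (fun _ _ => hyz _ _)
    (fun _ _ => hxz _ _)⟩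
  · intro v hv
    simp only [mem_union, mem_biUnion, mem_univ, true_and, mem_insert, mem_singleton,
      mem_image] at hv ⊢
    grind
  · have : ∑ j, triangleWeight G (x j) (y j) (z (φ j r))
        = s + ∑ j, (adjInd G (x j) (z (φ j r)) + adjInd G (y j) (z (φ j r))) := by
      have : (s : ℝ) = ∑ _j : Fin s, 1 := by simp
      conv_rhs => rw [this]
      rw [← sum_add_distrib]
      refine sum_congr rfl fun j _ => ?_
      rw [triangleWeight, adjInd_of_adj (hadj j)]
      ring
    rw [this]
    linarith

end RandomTriples

/-! ### Edge counts between vertex sets -/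

/-- The number of pairs in `A ×ˢ B` that are edges of `G`. -/
noncomputable def edgeSum {V : Type*} (G : SimpleGraph V) (A B : Finset V) : ℝ :=
  ∑ a ∈ A, ∑ b ∈ B, adjInd G a b

section EdgeSum

variable {V : Type*} {G : SimpleGraph V}

lemma edgeSum_nonneg (A B : Finset V) : 0 ≤ edgeSum G A B :=
  sum_nonneg fun _ _ => sum_nonneg fun _ _ => adjInd_nonneg _ _

lemma edgeSum_comm (A B : Finset V) : edgeSum G A B = edgeSum G B A := by
  unfold edgeSum
  rw [sum_comm]
  exact sum_congr rfl fun _ _ => sum_congr rfl fun _ _ => adjInd_comm _ _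

lemma edgeSum_le_card_mul_card (A B : Finset V) : edgeSum G A B ≤ #A * #B := by
  calc edgeSum G A B ≤ ∑ _a ∈ A, ∑ _b ∈ B, (1 : ℝ) :=
        sum_le_sum fun _ _ => sum_le_sum fun _ _ => adjInd_le_one _ _
    _ = #A * #B := by simp

lemma edgeSum_eq_zero {A B : Finset V} (h : ∀ a ∈ A, ∀ b ∈ B, ¬ G.Adj a b) :
    edgeSum G A B = 0 :=
  sum_eq_zero fun a ha => sum_eq_zero fun b hb => adjInd_of_not_adj (h a ha b hb)

variable [DecidableEq V]

lemma edgeSum_union_left {A B C : Finset V} (h : Disjoint A B) :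
    edgeSum G (A ∪ B) C = edgeSum G A C + edgeSum G B C :=
  sum_union h

lemma edgeSum_union_right {A B C : Finset V} (h : Disjoint A B) :
    edgeSum G C (A ∪ B) = edgeSum G C A + edgeSum G C B := by
  rw [edgeSum_comm, edgeSum_union_left h, edgeSum_comm A, edgeSum_comm B]

lemma edgeSum_union_self {A B : Finset V} (h : Disjoint A B) :
    edgeSum G (A ∪ B) (A ∪ B) = edgeSum G A A + 2 * edgeSum G A B + edgeSum G B B := by
  rw [edgeSum_union_left h, edgeSum_union_right h, edgeSum_union_right h, edgeSum_comm B A]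
  ring

/-- Each discarded vertex lies in at most `2 * #A` ordered pairs. This prices the rounding to
multiples of three. -/
lemma edgeSum_self_le_add {A B : Finset V} (h : B ⊆ A) :
    edgeSum G A A ≤ edgeSum G B B + 2 * (#A - #B) * #A := by
  have hd : Disjoint B (A \ B) := disjoint_sdiff
  have hc : ((#(A \ B) : ℕ) : ℝ) = #A - #B := by
    rw [card_sdiff_of_subset h, Nat.cast_sub (card_le_card h)]
  have h1 := edgeSum_union_self (G := G) hd
  rw [union_sdiff_of_subset h] at h1
  have h2 := edgeSum_le_card_mul_card (G := G) B (A \ B)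
  have h3 := edgeSum_le_card_mul_card (G := G) (A \ B) (A \ B)
  rw [hc] at h2 h3
  have h4 : (#B : ℝ) ≤ #A := by exact_mod_cast card_le_card h
  nlinarith

end EdgeSum

/-! ### Matchings with oriented edges, and tilings built from them -/

/-- A set of ordered pairs that are pairwise disjoint edges of `G`. -/
def IsPairMatching {V : Type*} (G : SimpleGraph V) (M : Finset (V × V)) : Prop :=
  (∀ p ∈ M, G.Adj p.1 p.2) ∧
    ∀ p ∈ M, ∀ q ∈ M, p.1 = q.1 ∨ p.1 = q.2 ∨ p.2 = q.1 ∨ p.2 = q.2 → p = q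

section PairMatching

variable {V : Type*} {G : SimpleGraph V} {M : Finset (V × V)}

lemma IsPairMatching.subset {M' : Finset (V × V)} (h : IsPairMatching G M) (hM : M' ⊆ M) :
    IsPairMatching G M' :=
  ⟨fun p hp => h.1 p (hM hp), fun p hp q hq => h.2 p (hM hp) q (hM hq)⟩

lemma IsPairMatching.injOn_fst (h : IsPairMatching G M) : Set.InjOn Prod.fst (M : Set (V × V)) :=
  fun p hp q hq hpq => h.2 p hp q hq (Or.inl hpq)

lemma IsPairMatching.injOn_snd (h : IsPairMatching G M) : Set.InjOn Prod.snd (M : Set (V × V)) :=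
  fun p hp q hq hpq => h.2 p hp q hq (Or.inr (Or.inr (Or.inr hpq)))

variable [DecidableEq V]

/-- The vertices covered by a set of pairs. -/
def pairVerts (M : Finset (V × V)) : Finset V :=
  M.image Prod.fst ∪ M.image Prod.snd

lemma mem_pairVerts {v : V} : v ∈ pairVerts M ↔ ∃ p ∈ M, v = p.1 ∨ v = p.2 := by
  simp only [pairVerts, mem_union, mem_image]
  grind

lemma pairVerts_mono {M' : Finset (V × V)} (hM : M' ⊆ M) : pairVerts M' ⊆ pairVerts M :=
  union_subset_union (image_subset_image hM) (image_subset_image hM)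

lemma IsPairMatching.mem_pairVerts_erase (h : IsPairMatching G M) {p : V × V} (hp : p ∈ M) {v : V} :
    v ∈ pairVerts (M.erase p) ↔ v ∈ pairVerts M ∧ v ≠ p.1 ∧ v ≠ p.2 := by
  simp only [mem_pairVerts, mem_erase]
  have := h.2 p hp
  grind

lemma mem_pairVerts_insert {p : V × V} {v : V} :
    v ∈ pairVerts (insert p M) ↔ v = p.1 ∨ v = p.2 ∨ v ∈ pairVerts M := by
  simp only [mem_pairVerts, mem_insert]
  grind

lemma IsPairMatching.insert (h : IsPairMatching G M) {a b : V} (hab : G.Adj a b)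
    (ha : a ∉ pairVerts M) (hb : b ∉ pairVerts M) :
    IsPairMatching G (insert (a, b) M) ∧ #(insert (a, b) M) = #M + 1 := by
  have hn : (a, b) ∉ M := fun hm => ha (mem_pairVerts.2 ⟨_, hm, Or.inl rfl⟩)
  refine ⟨⟨?_, ?_⟩, card_insert_of_notMem hn⟩
  · intro p hp
    rcases mem_insert.1 hp with rfl | hp
    · exact hab
    · exact h.1 p hp
  · simp only [mem_pairVerts, not_exists, not_and] at ha hb
    intro p hp q hq hpq
    have := h.2 p
    simp only [mem_insert] at hp hq
    grind

lemma IsPairMatching.disjoint_image (h : IsPairMatching G M) :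
    Disjoint (M.image Prod.fst) (M.image Prod.snd) := by
  rw [Finset.disjoint_left]
  simp only [mem_image, not_exists, not_and]
  rintro v ⟨p, hp, rfl⟩ q hq hqp
  have := h.2 p hp q hq (Or.inr (Or.inl hqp.symm))
  subst this
  exact (h.1 p hp).ne hqp.symm

lemma IsPairMatching.sum_pairVerts (h : IsPairMatching G M) (f : V → ℝ) :
    ∑ v ∈ pairVerts M, f v = ∑ p ∈ M, (f p.1 + f p.2) := by
  rw [pairVerts, sum_union h.disjoint_image, sum_image h.injOn_fst, sum_image h.injOn_snd,
    sum_add_distrib]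

lemma IsPairMatching.card_pairVerts (h : IsPairMatching G M) : #(pairVerts M) = 2 * #M := by
  rw [pairVerts, card_union_of_disjoint h.disjoint_image, card_image_of_injOn h.injOn_fst,
    card_image_of_injOn h.injOn_snd]
  ring

lemma IsPairMatching.image (h : IsPairMatching G M) {φ : V × V → V × V}
    (hφ : ∀ p, φ p = p ∨ φ p = p.swap) :
    IsPairMatching G (M.image φ) ∧ pairVerts (M.image φ) = pairVerts M ∧ #(M.image φ) = #M := by
  have hφ' : ∀ p, ((φ p).1 = p.1 ∧ (φ p).2 = p.2) ∨ ((φ p).1 = p.2 ∧ (φ p).2 = p.1) := by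
    intro p
    rcases hφ p with h | h <;> rw [h] <;> simp
  refine ⟨⟨?_, ?_⟩, ?_, ?_⟩
  · intro p hp
    obtain ⟨q, hq, rfl⟩ := mem_image.1 hp
    have := h.1 q hq
    have := this.symm
    rcases hφ' q with h | h <;> rwa [h.1, h.2]
  · intro p hp q hq hpq
    obtain ⟨p, hp', rfl⟩ := mem_image.1 hp
    obtain ⟨q, hq', rfl⟩ := mem_image.1 hq
    have := h.2 p hp' q hq' (by have := hφ' p; have := hφ' q; grind)
    rw [this]
  · ext v
    simp only [mem_pairVerts, exists_mem_image]
    refine exists_congr fun p => and_congr_right fun _ => ?_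
    have := hφ' p
    grind
  · refine card_image_of_injOn fun p hp q hq hpq => ?_
    refine h.2 p hp q hq ?_
    have := hφ' p
    have := hφ' q
    rw [hpq] at *
    grind

lemma sum_equiv_coe {ι α : Type*} [Fintype ι] {s : Finset α} (e : ι ≃ s) (f : α → ℝ) :
    ∑ i, f (e i) = ∑ a ∈ s, f a := by
  rw [Equiv.sum_comp e fun a : s => f a, sum_coe_sort]

lemma image_univ_equiv {ι α β : Type*} [Fintype ι] [DecidableEq β] {s : Finset α} (e : ι ≃ s)
    (f : α → β) : univ.image (fun i => f (e i)) = s.image f := by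
  ext b
  simp only [mem_image, mem_univ, true_and]
  constructor
  · rintro ⟨i, rfl⟩
    exact ⟨e i, (e i).2, rfl⟩
  · rintro ⟨a, ha, rfl⟩
    exact ⟨e.symm ⟨a, ha⟩, by simp⟩

/-- `hasPartialTiling_of_blocks` on all but at most two edges. The `8` pays for the discarded edges,
the diagonal correction `2 / 3`, and matchings with fewer than three edges. -/
lemma IsPairMatching.hasPartialTiling_pairVerts (h : IsPairMatching G M) :
    HasPartialTiling G (pairVerts M)
      (2 * #M / 3 + edgeSum G (pairVerts M) (pairVerts M) / (3 * #M) - 8) := by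
  set c := #M with hc
  obtain ⟨t, r, hr, hct⟩ : ∃ t r, r < 3 ∧ c = 3 * t + r := ⟨c / 3, c % 3, by omega, by omega⟩
  have hct' : (c : ℝ) = 3 * t + r := by exact_mod_cast hct
  have hr' : (r : ℝ) ≤ 2 := by exact_mod_cast Nat.lt_succ_iff.1 hr
  rcases Nat.eq_zero_or_pos t with rfl | ht
  · refine hasPartialTiling_of_nonpos ?_
    have h1 := edgeSum_le_card_mul_card (G := G) (pairVerts M) (pairVerts M)
    rw [h.card_pairVerts, ← hc] at h1
    push_cast at h1 hct'
    rcases Nat.eq_zero_or_pos c with h0 | h0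
    · rw [h0]; norm_num
    · have h0' : (0 : ℝ) < c := by exact_mod_cast h0
      have : edgeSum G (pairVerts M) (pairVerts M) / (3 * c) ≤ 2 * c := by
        rw [div_le_iff₀ (by positivity)]; nlinarith
      linarith
  obtain ⟨M', hM', hcard⟩ := exists_subset_card_eq (show 3 * t ≤ #M by omega)
  have h' := h.subset hM'
  have e : Fin t × Fin 3 ≃ M' := Fintype.equivOfCardEq (by
    simp [hcard]; ring)
  have hT := hasPartialTiling_of_blocks (G := G) (x := fun i => (e i).1.1) (y := fun i => (e i).1.2)
    (fun i j hij => e.injective (Subtype.ext (h'.injOn_fst (e i).2 (e j).2 hij)))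
    (fun i j hij => e.injective (Subtype.ext (h'.injOn_snd (e i).2 (e j).2 hij)))
    (fun i j hij => by
      have := h'.2 _ (e i).2 _ (e j).2 (Or.inr (Or.inl hij))
      rw [← this] at hij
      exact (h'.1 _ (e i).2).ne hij)
    (fun i => h'.1 _ (e i).2) ht
  rw [image_univ_equiv e Prod.fst, image_univ_equiv e Prod.snd] at hT
  refine hT.mono (pairVerts_mono hM') ?_
  have hE : ∑ k, ∑ l, (adjInd G (e k).1.1 (e l).1.1 + adjInd G (e k).1.1 (e l).1.2
      + adjInd G (e k).1.2 (e l).1.1 + adjInd G (e k).1.2 (e l).1.2)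
      = edgeSum G (pairVerts M') (pairVerts M') := by
    rw [edgeSum, h'.sum_pairVerts]
    rw [← sum_equiv_coe e fun p => ∑ b ∈ pairVerts M', adjInd G p.1 b
      + ∑ b ∈ pairVerts M', adjInd G p.2 b]
    refine sum_congr rfl fun k _ => ?_
    rw [h'.sum_pairVerts, h'.sum_pairVerts, ← sum_add_distrib]
    rw [← sum_equiv_coe e fun p => adjInd G (e k).1.1 p.1 + adjInd G (e k).1.1 p.2
      + (adjInd G (e k).1.2 p.1 + adjInd G (e k).1.2 p.2)]
    refine sum_congr rfl fun l _ => by ring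
  rw [hE]
  have h2 := edgeSum_self_le_add (G := G) (pairVerts_mono hM')
  rw [h.card_pairVerts, h'.card_pairVerts, hcard, ← hc] at h2
  push_cast at h2
  have ht' : (1 : ℝ) ≤ t := by exact_mod_cast ht
  have hr0 : (0 : ℝ) ≤ r := Nat.cast_nonneg r
  have hc0 : (0 : ℝ) < c := by rw [hct']; linarith
  have h0 := edgeSum_nonneg (G := G) (pairVerts M') (pairVerts M')
  generalize edgeSum G (pairVerts M') (pairVerts M') = E' at *
  generalize edgeSum G (pairVerts M) (pairVerts M) = E at *
  have h3 : E / (3 * c) ≤ E' / (9 * t) + 16 / 3 := by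
    have h4 : E / (3 * c) ≤ E' / (3 * c) + 16 / 3 := by
      rw [div_add' _ _ _ (by positivity)]
      refine div_le_div_of_nonneg_right ?_ (by positivity)
      nlinarith
    have h5 : E' / (3 * c) ≤ E' / (9 * t) :=
      div_le_div_of_nonneg_left h0 (by positivity) (by linarith)
    linarith
  have h6 : (E' - 6 * t) / (9 * t) = E' / (9 * t) - 2 / 3 := by
    field_simp; ring
  rw [h6]
  linarith

/-- `hasPartialTiling_of_injective` on all but at most two vertices, which the `4` pays for. -/
lemma hasPartialTiling_self (R : Finset V) :
    HasPartialTiling G R (edgeSum G R R / #R - 4) := by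
  obtain ⟨t, r, hr, hct⟩ : ∃ t r, r < 3 ∧ #R = 3 * t + r := ⟨#R / 3, #R % 3, by omega, by omega⟩
  have hct' : (#R : ℝ) = 3 * t + r := by exact_mod_cast hct
  have hr' : (r : ℝ) ≤ 2 := by exact_mod_cast Nat.lt_succ_iff.1 hr
  rcases Nat.eq_zero_or_pos t with rfl | ht
  · refine hasPartialTiling_of_nonpos ?_
    have h1 := edgeSum_le_card_mul_card (G := G) R R
    push_cast at hct'
    rcases Nat.eq_zero_or_pos #R with h0 | h0
    · rw [h0]; norm_num
    · have h0' : (0 : ℝ) < #R := by exact_mod_cast h0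
      have : edgeSum G R R / #R ≤ #R := by
        rw [div_le_iff₀ (by positivity)]; nlinarith
      linarith
  obtain ⟨R', hR', hcard⟩ := exists_subset_card_eq (show 3 * t ≤ #R by omega)
  have e : Fin t × Fin 3 ≃ R' := Fintype.equivOfCardEq (by
    simp [hcard]; ring)
  have hT := hasPartialTiling_of_injective (G := G) (z := fun i => (e i).1)
    (fun i j hij => e.injective (Subtype.ext hij)) ht
  have hE : ∑ k, ∑ l, adjInd G (e k).1 (e l).1 = edgeSum G R' R' := by
    rw [edgeSum, ← sum_equiv_coe e]
    refine sum_congr rfl fun k _ => ?_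
    rw [← sum_equiv_coe e]
  rw [hE] at hT
  have himg := image_univ_equiv e (fun v => v)
  simp only [image_id'] at himg
  rw [himg] at hT
  refine hT.mono hR' ?_
  have h2 := edgeSum_self_le_add (G := G) hR'
  rw [hcard] at h2
  push_cast at h2
  have ht' : (1 : ℝ) ≤ t := by exact_mod_cast ht
  have hr0 : (0 : ℝ) ≤ r := Nat.cast_nonneg r
  have hc0 : (0 : ℝ) < #R := by rw [hct']; linarith
  have h0 := edgeSum_nonneg (G := G) R' R'
  generalize edgeSum G R' R' = E' at *
  generalize edgeSum G R R = E at *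
  have h4 : E / #R ≤ E' / #R + 4 := by
    rw [div_add' _ _ _ (by positivity)]
    refine div_le_div_of_nonneg_right ?_ (by positivity)
    nlinarith
  have h5 : E' / #R ≤ E' / (3 * t) :=
    div_le_div_of_nonneg_left h0 (by positivity) (by linarith)
  linarith

lemma IsPairMatching.hasPartialTiling_union (h : IsPairMatching G M) {U : Finset V}
    (hd : Disjoint (pairVerts M) U) (hMU : #M ≤ #U) :
    HasPartialTiling G (pairVerts M ∪ U) (#M + edgeSum G (pairVerts M) U / #U) := by
  rcases Nat.eq_zero_or_pos #U with h0 | h0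
  · refine hasPartialTiling_of_nonpos ?_
    rw [h0, Nat.le_zero] at hMU
    rw [hMU, h0]; simp
  have e : Fin #M ≃ M := M.equivFin.symm
  have e' : Fin #U ≃ U := U.equivFin.symm
  have hv : ∀ i, (e i).1.1 ∈ pairVerts M ∧ (e i).1.2 ∈ pairVerts M := fun i =>
    ⟨mem_pairVerts.2 ⟨_, (e i).2, Or.inl rfl⟩, mem_pairVerts.2 ⟨_, (e i).2, Or.inr rfl⟩⟩
  have hT := hasPartialTiling_of_edges_of_vertices (G := G) hMU h0 (x := fun i => (e i).1.1)
    (y := fun i => (e i).1.2) (z := fun i => (e' i).1)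
    (fun i j hij => e.injective (Subtype.ext (h.injOn_fst (e i).2 (e j).2 hij)))
    (fun i j hij => e.injective (Subtype.ext (h.injOn_snd (e i).2 (e j).2 hij)))
    (fun i j hij => e'.injective (Subtype.ext hij))
    (fun i j hij => by
      have := h.2 _ (e i).2 _ (e j).2 (Or.inr (Or.inl hij))
      rw [← this] at hij
      exact (h.1 _ (e i).2).ne hij)
    (fun i j hij => Finset.disjoint_left.1 hd (hv i).2 (by rw [hij]; exact (e' j).2))
    (fun i j hij => Finset.disjoint_left.1 hd (hv i).1 (by rw [hij]; exact (e' j).2))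
    (fun i => h.1 _ (e i).2)
  have himg := image_univ_equiv e' (fun v => v)
  simp only [image_id'] at himg
  rw [image_univ_equiv e Prod.fst, image_univ_equiv e Prod.snd, himg] at hT
  have hE : ∑ j, ∑ k, (adjInd G (e j).1.1 (e' k).1 + adjInd G (e j).1.2 (e' k).1)
      = edgeSum G (pairVerts M) U := by
    rw [edgeSum, h.sum_pairVerts,
      ← sum_equiv_coe e fun p => ∑ b ∈ U, adjInd G p.1 b + ∑ b ∈ U, adjInd G p.2 b]
    refine sum_congr rfl fun j _ => ?_
    rw [← sum_add_distrib, ← sum_equiv_coe e' fun b => adjInd G (e j).1.1 b + adjInd G (e j).1.2 b]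
  rw [hE] at hT
  exact hT

end PairMatching

/-! ### Augmenting paths of a maximum matching -/

section MaximumMatching

variable {V : Type*} {G : SimpleGraph V} {M : Finset (V × V)}

/-- A matching of maximum size. -/
def IsMaxPairMatching (G : SimpleGraph V) (M : Finset (V × V)) : Prop :=
  IsPairMatching G M ∧ ∀ M', IsPairMatching G M' → #M' ≤ #M

lemma exists_isMaxPairMatching [Fintype V] (G : SimpleGraph V) : ∃ M, IsMaxPairMatching G M := by
  classical
  obtain ⟨M, hM, hmax⟩ := exists_max_image
    ((univ : Finset (Finset (V × V))).filter (IsPairMatching G)) card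
    ⟨∅, by simp [IsPairMatching]⟩
  exact ⟨M, (mem_filter.1 hM).2, fun M' hM' => hmax M' (mem_filter.2 ⟨mem_univ _, hM'⟩)⟩

variable [DecidableEq V]

/-- `v` has two neighbours that `M` leaves uncovered. -/
def HasTwoFreeNeighbors (G : SimpleGraph V) (M : Finset (V × V)) (v : V) : Prop :=
  ∀ u, ∃ u' ∉ pairVerts M, G.Adj v u' ∧ u' ≠ u

lemma sum_adjInd_compl_le_one [Fintype V] {v : V} (h : ¬ HasTwoFreeNeighbors G M v) :
    ∑ b ∈ (pairVerts M)ᶜ, adjInd G v b ≤ 1 := by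
  unfold HasTwoFreeNeighbors at h
  push Not at h
  obtain ⟨u, hu⟩ := h
  calc ∑ b ∈ (pairVerts M)ᶜ, adjInd G v b
      ≤ ∑ b ∈ (pairVerts M)ᶜ, if b = u then (1 : ℝ) else 0 := by
        refine sum_le_sum fun b hb => ?_
        split_ifs with hbu
        · exact adjInd_le_one _ _
        · rw [adjInd_of_not_adj fun hadj => hbu (hu b (mem_compl.1 hb) hadj)]
    _ ≤ 1 := by
        rw [sum_ite_eq']
        split_ifs <;> norm_num

lemma IsMaxPairMatching.not_adj_of_free (h : IsMaxPairMatching G M) {u u' : V}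
    (hu : u ∉ pairVerts M) (hu' : u' ∉ pairVerts M) : ¬ G.Adj u u' := by
  intro hadj
  obtain ⟨h1, h2⟩ := h.1.insert hadj hu hu'
  have := h.2 _ h1
  omega

/-- Otherwise the path `u`, `p.2`, `p.1`, `u'` augments `M`; having two free neighbours lets `u'`
differ from `u`. -/
lemma IsMaxPairMatching.not_adj_snd_free (h : IsMaxPairMatching G M) {p : V × V} (hp : p ∈ M)
    (hgood : HasTwoFreeNeighbors G M p.1) {u : V} (hu : u ∉ pairVerts M) : ¬ G.Adj p.2 u := by
  intro hadj
  obtain ⟨u', hu', hadj', hne⟩ := hgood u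
  have hp1 : p.1 ∈ pairVerts M := mem_pairVerts.2 ⟨p, hp, Or.inl rfl⟩
  have hp2 : p.2 ∈ pairVerts M := mem_pairVerts.2 ⟨p, hp, Or.inr rfl⟩
  have hp12 := (h.1.1 p hp).ne
  have h0 := h.1.subset (erase_subset p M)
  have m0 : ∀ v, v ∈ pairVerts (M.erase p) ↔ v ∈ pairVerts M ∧ v ≠ p.1 ∧ v ≠ p.2 := fun v =>
    h.1.mem_pairVerts_erase hp
  obtain ⟨h1, c1⟩ := h0.insert hadj (by rw [m0]; tauto) (by rw [m0]; tauto)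
  have m1 := fun v => mem_pairVerts_insert (M := M.erase p) (p := (p.2, u)) (v := v)
  simp only [m0] at m1
  obtain ⟨h2, c2⟩ := h1.insert hadj' (by rw [m1]; grind) (by rw [m1]; grind)
  have := h.2 _ h2
  have := card_erase_of_mem hp
  have := card_pos.2 ⟨p, hp⟩
  omega

/-- Otherwise `u`, `p.1`, `p.2`, `q.2`, `q.1`, `u'` is an augmenting path with distinct free ends.
-/
lemma IsMaxPairMatching.not_adj_snd_snd (h : IsMaxPairMatching G M) {p q : V × V} (hp : p ∈ M)
    (hq : q ∈ M) (hpgood : HasTwoFreeNeighbors G M p.1) (hqgood : HasTwoFreeNeighbors G M q.1) :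
    ¬ G.Adj p.2 q.2 := by
  intro hadj
  have hpq : p ≠ q := fun h => hadj.ne (by rw [h])
  obtain ⟨u, hu, hadjp, -⟩ := hpgood p.1
  obtain ⟨u', hu', hadjq, hne⟩ := hqgood u
  have hv : ∀ r ∈ M, r.1 ∈ pairVerts M ∧ r.2 ∈ pairVerts M := fun r hr =>
    ⟨mem_pairVerts.2 ⟨r, hr, Or.inl rfl⟩, mem_pairVerts.2 ⟨r, hr, Or.inr rfl⟩⟩
  have hvp := hv p hp
  have hvq := hv q hq
  have hpe : p ∈ M.erase q := mem_erase.2 ⟨hpq, hp⟩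
  have hd := h.1.2 p hp q hq
  have hp12 := (h.1.1 p hp).ne
  have hq12 := (h.1.1 q hq).ne
  have h0 := h.1.subset (erase_subset q M)
  have h0' := h0.subset (erase_subset p (M.erase q))
  have m0 : ∀ v, v ∈ pairVerts ((M.erase q).erase p) ↔
      (v ∈ pairVerts M ∧ v ≠ q.1 ∧ v ≠ q.2) ∧ v ≠ p.1 ∧ v ≠ p.2 := fun v => by
    rw [h0.mem_pairVerts_erase hpe, h.1.mem_pairVerts_erase hq]
  obtain ⟨h1, c1⟩ := h0'.insert hadj (by rw [m0]; tauto) (by rw [m0]; tauto)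
  have m1 := fun v => mem_pairVerts_insert (M := (M.erase q).erase p) (p := (p.2, q.2)) (v := v)
  simp only [m0] at m1
  obtain ⟨h2, c2⟩ := h1.insert hadjp (by rw [m1]; grind) (by rw [m1]; grind)
  have m2 := fun v => mem_pairVerts_insert (M := insert (p.2, q.2) ((M.erase q).erase p))
    (p := (p.1, u)) (v := v)
  simp only [m1] at m2
  obtain ⟨h3, c3⟩ := h2.insert hadjq (by rw [m2]; grind) (by rw [m2]; grind)
  have := h.2 _ h3
  have := card_erase_of_mem hq
  have := card_erase_of_mem hpe
  have := card_pos.2 ⟨q, hq⟩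
  have := card_pos.2 ⟨p, hpe⟩
  omega

/-- Otherwise `u`, `p.1`, `p.2`, `r.1`, `r.2`, `q.2`, `q.1`, `u'` is an augmenting path: three
matching edges become four. -/
lemma IsMaxPairMatching.not_adj_and_adj (h : IsMaxPairMatching G M) {p q r : V × V} (hp : p ∈ M)
    (hq : q ∈ M) (hr : r ∈ M) (hpq : p ≠ q) (hrp : r ≠ p) (hrq : r ≠ q)
    (hpgood : HasTwoFreeNeighbors G M p.1) (hqgood : HasTwoFreeNeighbors G M q.1) :
    ¬ (G.Adj r.1 p.2 ∧ G.Adj r.2 q.2) := by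
  rintro ⟨hadj1, hadj2⟩
  obtain ⟨u, hu, hadjp, -⟩ := hpgood p.1
  obtain ⟨u', hu', hadjq, hne⟩ := hqgood u
  have hv : ∀ r ∈ M, r.1 ∈ pairVerts M ∧ r.2 ∈ pairVerts M := fun r hr =>
    ⟨mem_pairVerts.2 ⟨r, hr, Or.inl rfl⟩, mem_pairVerts.2 ⟨r, hr, Or.inr rfl⟩⟩
  have hvp := hv p hp
  have hvq := hv q hq
  have hvr := hv r hr
  have hpe : p ∈ M.erase q := mem_erase.2 ⟨hpq, hp⟩
  have hre : r ∈ (M.erase q).erase p := mem_erase.2 ⟨hrp, mem_erase.2 ⟨hrq, hr⟩⟩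
  have hd := h.1.2 p hp q hq
  have hd1 := h.1.2 r hr p hp
  have hd2 := h.1.2 r hr q hq
  have hp12 := (h.1.1 p hp).ne
  have hq12 := (h.1.1 q hq).ne
  have hr12 := (h.1.1 r hr).ne
  have h0 := h.1.subset (erase_subset q M)
  have h0' := h0.subset (erase_subset p (M.erase q))
  have h0'' := h0'.subset (erase_subset r ((M.erase q).erase p))
  have m0 : ∀ v, v ∈ pairVerts (((M.erase q).erase p).erase r) ↔
      ((v ∈ pairVerts M ∧ v ≠ q.1 ∧ v ≠ q.2) ∧ v ≠ p.1 ∧ v ≠ p.2) ∧ v ≠ r.1 ∧ v ≠ r.2 :=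
    fun v => by
      rw [h0'.mem_pairVerts_erase hre, h0.mem_pairVerts_erase hpe, h.1.mem_pairVerts_erase hq]
  obtain ⟨h1, c1⟩ := h0''.insert hadj1 (by rw [m0]; tauto) (by rw [m0]; tauto)
  have m1 := fun v => mem_pairVerts_insert (M := ((M.erase q).erase p).erase r)
    (p := (r.1, p.2)) (v := v)
  simp only [m0] at m1
  obtain ⟨h2, c2⟩ := h1.insert hadj2 (by rw [m1]; grind) (by rw [m1]; grind)
  have m2 := fun v => mem_pairVerts_insert
    (M := insert (r.1, p.2) (((M.erase q).erase p).erase r)) (p := (r.2, q.2)) (v := v)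
  simp only [m1] at m2
  obtain ⟨h3, c3⟩ := h2.insert hadjp (by rw [m2]; grind) (by rw [m2]; grind)
  have m3 := fun v => mem_pairVerts_insert
    (M := insert (r.2, q.2) (insert (r.1, p.2) (((M.erase q).erase p).erase r)))
    (p := (p.1, u)) (v := v)
  simp only [m2] at m3
  obtain ⟨h4, c4⟩ := h3.insert hadjq (by rw [m3]; grind) (by rw [m3]; grind)
  have := h.2 _ h4
  have := card_erase_of_mem hq
  have := card_erase_of_mem hpe
  have := card_erase_of_mem hre
  have := card_pos.2 ⟨q, hq⟩
  have := card_pos.2 ⟨p, hpe⟩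
  have := card_pos.2 ⟨r, hre⟩
  omega

/-- Orient the edges of a maximum matching such that the endpoints with two free neighbours come
first. -/
lemma exists_oriented_isMaxPairMatching [Fintype V] (G : SimpleGraph V) :
    ∃ S N : Finset (V × V), Disjoint S N ∧ IsMaxPairMatching G (S ∪ N) ∧
      (∀ p ∈ S, HasTwoFreeNeighbors G (S ∪ N) p.1) ∧
      ∀ p ∈ N, ¬ HasTwoFreeNeighbors G (S ∪ N) p.1 ∧ ¬ HasTwoFreeNeighbors G (S ∪ N) p.2 := by
  classical
  obtain ⟨M, hM⟩ := exists_isMaxPairMatching G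
  set φ : V × V → V × V := fun p => if HasTwoFreeNeighbors G M p.1 then p else p.swap with hφ
  obtain ⟨h1, h2, h3⟩ := hM.1.image (φ := φ) fun p => by
    simp only [hφ]; split_ifs <;> simp
  -- Reorienting edges leaves the covered set, hence the free neighbours, unchanged.
  have hgood : ∀ v, HasTwoFreeNeighbors G (M.image φ) v ↔ HasTwoFreeNeighbors G M v := by
    intro v; unfold HasTwoFreeNeighbors; rw [h2]
  refine ⟨(M.image φ).filter fun p => HasTwoFreeNeighbors G M p.1,
    (M.image φ).filter fun p => ¬ HasTwoFreeNeighbors G M p.1, disjoint_filter_filter_not _ _ _, ?_⟩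
  rw [filter_union_filter_not_eq]
  refine ⟨⟨h1, fun M' hM' => by rw [h3]; exact hM.2 M' hM'⟩, ?_, ?_⟩
  · intro p hp
    rw [hgood]; exact (mem_filter.1 hp).2
  · intro p hp
    rw [hgood, hgood]
    obtain ⟨hp1, hp2⟩ := mem_filter.1 hp
    refine ⟨hp2, ?_⟩
    obtain ⟨q, hq, rfl⟩ := mem_image.1 hp1
    simp only [hφ] at hp2 ⊢
    split_ifs at hp2 ⊢ with hq
    · exact absurd hq hp2
    · simpa using hq

end MaximumMatching

/-! ### Edge counts around a maximum matching -/

section EdgeBounds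

variable {V : Type*} {G : SimpleGraph V} {S N : Finset (V × V)}

/-- If both `a` and `b` have neighbours among the second endpoints, each has only one; otherwise one
of the two sums vanishes. -/
lemma sum_adjInd_add_adjInd_le {a b : V} (S : Finset (V × V))
    (h : ∀ p ∈ S, ∀ q ∈ S, p ≠ q → ¬ (G.Adj a p.2 ∧ G.Adj b q.2)) :
    ∑ p ∈ S, (adjInd G a p.2 + adjInd G b p.2) ≤ #S + 2 := by
  classical
  rw [sum_add_distrib]
  have hle : ∀ v, ∑ p ∈ S, adjInd G v p.2 ≤ #S := fun v => by
    calc _ ≤ ∑ _p ∈ S, (1 : ℝ) := sum_le_sum fun _ _ => adjInd_le_one _ _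
      _ = #S := by simp
  have hone : ∀ v, (∃ q ∈ S, ∀ p ∈ S, G.Adj v p.2 → p = q) → ∑ p ∈ S, adjInd G v p.2 ≤ 1 := by
    rintro v ⟨q, hq, hv⟩
    rw [sum_eq_single_of_mem q hq fun p hp hpq => adjInd_of_not_adj fun ha => hpq (hv p hp ha)]
    exact adjInd_le_one _ _
  have hzero : ∀ v, (∀ p ∈ S, ¬ G.Adj v p.2) → ∑ p ∈ S, adjInd G v p.2 = 0 := fun v hv =>
    sum_eq_zero fun p hp => adjInd_of_not_adj (hv p hp)
  by_cases ha : ∃ p ∈ S, G.Adj a p.2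
  · by_cases hb : ∃ q ∈ S, G.Adj b q.2
    · obtain ⟨p, hp, hap⟩ := ha
      obtain ⟨q, hq, hbq⟩ := hb
      have h1 := hone b ⟨p, hp, fun q hq hbq => by
        by_contra hne; exact h p hp q hq (Ne.symm hne) ⟨hap, hbq⟩⟩
      have h2 := hone a ⟨q, hq, fun p hp hap => by
        by_contra hne; exact h p hp q hq hne ⟨hap, hbq⟩⟩
      have : (0 : ℝ) ≤ #S := Nat.cast_nonneg _
      linarith
    · push Not at hb
      rw [hzero b hb]
      linarith [hle a]
  · push Not at ha
    rw [hzero a ha]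
    linarith [hle b]

variable [Fintype V] [DecidableEq V]

/-- Edge counts around an oriented maximum matching `S ∪ N`. -/
lemma edgeSum_bounds (hd : Disjoint S N) (hM : IsMaxPairMatching G (S ∪ N))
    (hS : ∀ p ∈ S, HasTwoFreeNeighbors G (S ∪ N) p.1)
    (hN : ∀ p ∈ N, ¬ HasTwoFreeNeighbors G (S ∪ N) p.1 ∧ ¬ HasTwoFreeNeighbors G (S ∪ N) p.2) :
    edgeSum G (pairVerts S) (pairVerts (S ∪ N))ᶜ ≤ #S * #(pairVerts (S ∪ N))ᶜ ∧
    ∑ a, ∑ b, adjInd G a b ≤ 3 * (#S : ℝ) ^ 2 + 2 * (#N * (3 * #S + 2))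
      + edgeSum G (pairVerts N) (pairVerts N)
      + 2 * edgeSum G (pairVerts S) (pairVerts (S ∪ N))ᶜ + 4 * #N := by
  set U := (pairVerts (S ∪ N))ᶜ with hU
  have hSM : ∀ {p}, p ∈ S → p ∈ S ∪ N := fun h => mem_union_left _ h
  have hNM : ∀ {p}, p ∈ N → p ∈ S ∪ N := fun h => mem_union_right _ h
  have hMS : IsPairMatching G S := hM.1.subset subset_union_left
  have hMN : IsPairMatching G N := hM.1.subset subset_union_right
  have hverts : pairVerts (S ∪ N) = pairVerts S ∪ pairVerts N := by
    ext v
    simp only [mem_union, mem_pairVerts]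
    grind
  have hdSN : Disjoint (pairVerts S) (pairVerts N) := by
    rw [Finset.disjoint_left]
    intro v hvS hvN
    obtain ⟨p, hp, hvp⟩ := mem_pairVerts.1 hvS
    obtain ⟨q, hq, hvq⟩ := mem_pairVerts.1 hvN
    have := hM.1.2 p (hSM hp) q (hNM hq) (by grind)
    subst this
    exact Finset.disjoint_left.1 hd hp hq
  have hUfree : ∀ u ∈ U, u ∉ pairVerts (S ∪ N) := fun u hu => mem_compl.1 hu
  have hsum1 : ∀ (A : Finset V) (v : V), ∑ b ∈ A, adjInd G v b ≤ #A := fun A v => by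
    calc _ ≤ ∑ _p ∈ A, (1 : ℝ) := sum_le_sum fun _ _ => adjInd_le_one _ _
      _ = #A := by simp
  have hSU : edgeSum G (pairVerts S) U ≤ #S * #U := by
    rw [edgeSum, hMS.sum_pairVerts]
    have : ∀ p ∈ S, ∑ b ∈ U, adjInd G p.1 b + ∑ b ∈ U, adjInd G p.2 b ≤ #U := by
      intro p hp
      rw [sum_eq_zero (s := U) (f := fun b => adjInd G p.2 b) fun u hu =>
        adjInd_of_not_adj (hM.not_adj_snd_free (hSM hp) (hS p hp) (hUfree u hu)), add_zero]
      exact hsum1 U p.1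
    calc _ ≤ ∑ _p ∈ S, (#U : ℝ) := sum_le_sum this
      _ = #S * #U := by simp
  refine ⟨hSU, ?_⟩
  have hNU : edgeSum G (pairVerts N) U ≤ 2 * #N := by
    rw [edgeSum, hMN.sum_pairVerts]
    calc _ ≤ ∑ _p ∈ N, (2 : ℝ) := sum_le_sum fun p hp => by
          linarith [sum_adjInd_compl_le_one (hN p hp).1, sum_adjInd_compl_le_one (hN p hp).2]
      _ = 2 * #N := by simp; ring
  have hUU : edgeSum G U U = 0 := edgeSum_eq_zero fun a ha b hb =>
    hM.not_adj_of_free (hUfree a ha) (hUfree b hb)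
  have hSS : edgeSum G (pairVerts S) (pairVerts S) ≤ 3 * (#S : ℝ) ^ 2 := by
    rw [edgeSum, hMS.sum_pairVerts]
    have : ∀ p ∈ S, ∑ b ∈ pairVerts S, adjInd G p.1 b + ∑ b ∈ pairVerts S, adjInd G p.2 b
        ≤ #S * 3 := by
      intro p hp
      rw [hMS.sum_pairVerts, hMS.sum_pairVerts, ← sum_add_distrib]
      calc _ ≤ ∑ _q ∈ S, (3 : ℝ) := sum_le_sum fun q hq => by
            rw [adjInd_of_not_adj (hM.not_adj_snd_snd (hSM hp) (hSM hq) (hS p hp) (hS q hq))]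
            linarith [adjInd_le_one (G := G) p.1 q.1, adjInd_le_one (G := G) p.1 q.2,
              adjInd_le_one (G := G) p.2 q.1]
        _ = #S * 3 := by simp
    calc _ ≤ ∑ _p ∈ S, (#S * 3 : ℝ) := sum_le_sum this
      _ = 3 * (#S : ℝ) ^ 2 := by simp; ring
  have hSN : edgeSum G (pairVerts S) (pairVerts N) ≤ #N * (3 * #S + 2) := by
    rw [edgeSum_comm, edgeSum, hMN.sum_pairVerts]
    have : ∀ r ∈ N, ∑ b ∈ pairVerts S, adjInd G r.1 b + ∑ b ∈ pairVerts S, adjInd G r.2 b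
        ≤ 3 * #S + 2 := by
      intro r hr
      have h1 := sum_adjInd_add_adjInd_le (G := G) (a := r.1) (b := r.2) S
        fun p hp q hq hpq => hM.not_adj_and_adj (hSM hp) (hSM hq) (hNM hr) hpq
          (fun h => Finset.disjoint_left.1 hd hp (h ▸ hr))
          (fun h => Finset.disjoint_left.1 hd hq (h ▸ hr)) (hS p hp) (hS q hq)
      have h2 : ∑ p ∈ S, (adjInd G r.1 p.1 + adjInd G r.2 p.1) ≤ 2 * #S := by
        calc _ ≤ ∑ _p ∈ S, (2 : ℝ) := sum_le_sum fun p _ => by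
              linarith [adjInd_le_one (G := G) r.1 p.1, adjInd_le_one (G := G) r.2 p.1]
          _ = 2 * #S := by simp; ring
      rw [hMS.sum_pairVerts, hMS.sum_pairVerts]
      simp only [sum_add_distrib] at h1 h2 ⊢
      linarith
    calc _ ≤ ∑ _r ∈ N, (3 * #S + 2 : ℝ) := sum_le_sum this
      _ = #N * (3 * #S + 2) := by simp; ring
  have htot : ∑ a, ∑ b, adjInd G a b = edgeSum G univ univ := rfl
  have hdU : Disjoint (pairVerts S ∪ pairVerts N) U := by
    rw [← hverts]; exact disjoint_compl_right
  have huniv : (univ : Finset V) = (pairVerts S ∪ pairVerts N) ∪ U := by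
    rw [← hverts, hU, union_compl]
  rw [htot, huniv, edgeSum_union_self hdU, edgeSum_union_self hdSN, edgeSum_union_left hdSN, hUU]
  linarith

end EdgeBounds

/-! ### Optimisation and the triangle bound -/

section TriangleFactor

variable {V : Type*} [Fintype V] [DecidableEq V] {G : SimpleGraph V}

/-- After multiplication by `n`, the edge count `hsum`, taken with factor 3/2, eliminates `X`; a
quadratic inequality in `s` and `c` remains. -/
lemma tiling_bound_of_edge_bounds {n s c u X E : ℝ} (hn : 1 ≤ n) (hs : 0 ≤ s) (hc : 0 ≤ c)
    (hsc : 3 * (s + c) ≤ n) (hu : u = n - 2 * s - 2 * c) (hX0 : X ≤ s * u)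
    (hE : E ≤ 4 * c ^ 2) (hE0 : 0 ≤ E)
    (hsum : n * (n - 1) / 2 ≤ 3 * s ^ 2 + 2 * (c * (3 * s + 2)) + E + 2 * X + 4 * c) :
    561 / 1000 * n - 5 ≤ s + X / u + 2 * c / 3 + E / (3 * c) := by
  have hu0 : 0 < u := by linarith
  -- The two sides differ by `(3 u - n) (s - X / u)`, and `u ≥ n / 3` by `hsc`.
  have hXu : 3 * X - s * (3 * u - n) ≤ n * (X / u) := by
    have h1 : X / u ≤ s := by rw [div_le_iff₀ hu0]; exact hX0
    have h2 : X = u * (X / u) := by field_simp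
    nlinarith [mul_nonneg (sub_nonneg.2 h1) (show (0 : ℝ) ≤ 3 * u - n by linarith)]
  have hz : E / (3 * c) ≤ 4 * c / 3 := by
    rcases hc.eq_or_lt with rfl | hc'
    · simp
    · rw [div_le_iff₀ (by positivity)]; nlinarith
  have hE1 : E = 3 * c * (E / (3 * c)) := by
    rcases hc.eq_or_lt with rfl | hc'
    · simp; nlinarith
    · field_simp
  have hEpos : 0 ≤ E / (3 * c) := by positivity
  generalize X / u = x at *
  generalize E / (3 * c) = z at *
  refine le_of_mul_le_mul_left ?_ (show (0 : ℝ) < n by linarith)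
  -- This product is the drop of the quadratic when `s` is raised to `n / 3 - c`, the worst case. If
  -- `E` cancels, 7n²/12 - cn/3 + 9c²/2 is left up to linear terms, with minimum at `c = n / 27`.
  have h0 : 0 ≤ (n / 3 - c - s) * (n + 3 * c - 3 / 2 * (s + (n / 3 - c))) :=
    mul_nonneg (by linarith) (by linarith)
  -- As `E = 3 c z`, the term `n z` absorbs `3 / 2 * E` exactly when `9 c ≤ 2 n` (for `z > 0`);
  -- beyond that, `z ≤ 4 c / 3` bounds the deficit.
  rcases le_total (9 * c) (2 * n) with h9 | h9
  · have h1 : 3 / 2 * E ≤ n * z := by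
      nlinarith [mul_nonneg hEpos (sub_nonneg.2 h9)]
    nlinarith [sq_nonneg (c - n / 27)]
  · have h1 : 3 / 2 * E + 2 * c / 3 * (2 * n - 9 * c) ≤ n * z := by
      nlinarith [mul_nonneg (sub_nonneg.2 hz) (sub_nonneg.2 h9)]
    have h2 : 0 ≤ c * (n - 3 * c) := mul_nonneg hc (by linarith)
    nlinarith

/-- A matching that covers two thirds of the vertices yields many good triangles. -/
lemma hasPartialTiling_of_large_matching {M : Finset (V × V)} (hM : IsPairMatching G M)
    (hcard : Fintype.card V = 3 * #M)
    (hsum : ∑ a, ∑ b, adjInd G a b = (Fintype.card V : ℝ) * ((Fintype.card V : ℝ) - 1) / 2) :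
    HasPartialTiling G univ (17 / 10 * #M - 13) := by
  rcases Nat.eq_zero_or_pos #M with h0 | h0
  · exact hasPartialTiling_of_nonpos (by rw [h0]; norm_num)
  have h0' : (0 : ℝ) < #M := by exact_mod_cast h0
  set R := (pairVerts M)ᶜ with hR
  have hRc : #R = #M := by
    rw [hR, card_compl, hM.card_pairVerts, hcard]; omega
  have hd : Disjoint (pairVerts M) R := disjoint_compl_right
  have huniv : pairVerts M ∪ R = univ := by rw [hR, union_compl]
  have T1 := hM.hasPartialTiling_union hd hRc.ge
  have T2 := hM.hasPartialTiling_pairVerts.union (hasPartialTiling_self (G := G) R) hd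
  rw [huniv] at T1 T2
  have htot : ∑ a, ∑ b, adjInd G a b = edgeSum G univ univ := rfl
  rw [htot, ← huniv, edgeSum_union_self hd, hcard] at hsum
  push_cast at hsum
  rw [hRc] at T1 T2
  have hRR := edgeSum_nonneg (G := G) R R
  generalize edgeSum G (pairVerts M) (pairVerts M) = E at *
  generalize edgeSum G R R = F at *
  have e1 : edgeSum G (pairVerts M) R = #M * (edgeSum G (pairVerts M) R / #M) :=
    (mul_div_cancel₀ _ h0'.ne').symm
  have e2 : E = 3 * #M * (E / (3 * #M)) :=
    (mul_div_cancel₀ _ (mul_pos three_pos h0').ne').symm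
  have e3 : F = #M * (F / #M) := (mul_div_cancel₀ _ h0'.ne').symm
  rw [e1] at hsum
  have hF : 0 ≤ F / #M := div_nonneg hRR h0'.le
  generalize edgeSum G (pairVerts M) R / (#M : ℝ) = x at *
  generalize E / (3 * (#M : ℝ)) = y at *
  generalize F / (#M : ℝ) = z at *
  rw [e2, e3] at hsum
  have hsum' : 3 * y + 2 * x + z = (9 * #M - 3) / 2 := by
    refine mul_left_cancel₀ h0'.ne' ?_
    linarith
  -- At `x = 7 / 10 * #M` both tilings reach `17 / 10 * #M` up to constants, the second because `y +
  -- z ≥ (3 y + z) / 3`.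
  rcases le_total (7 / 10 * (#M : ℝ)) x with hx | hx
  · exact T1.mono (subset_refl _) (by linarith)
  · exact T2.mono (subset_refl _) (by linarith)

/-- A graph with half of all edges has some disjoint triples of vertices that contain many edges. -/
theorem exists_hasPartialTiling (h3 : 3 ∣ Fintype.card V)
    (hsum : ∑ a, ∑ b, adjInd G a b = (Fintype.card V : ℝ) * ((Fintype.card V : ℝ) - 1) / 2) :
    HasPartialTiling G univ (561 / 1000 * (Fintype.card V : ℝ) - 13) := by
  obtain ⟨t, ht⟩ := h3
  obtain ⟨S, N, hd, hM, hS, hN⟩ := exists_oriented_isMaxPairMatching G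
  rcases le_or_gt t #(S ∪ N) with hle | hlt
  · obtain ⟨M', hM', hcard⟩ := exists_subset_card_eq hle
    refine (hasPartialTiling_of_large_matching (hM.1.subset hM') (by rw [hcard, ht]) hsum).mono
      (subset_refl _) ?_
    rw [hcard, ht]
    push_cast
    have : (0 : ℝ) ≤ t := Nat.cast_nonneg t
    linarith
  · obtain ⟨hX, hedges⟩ := edgeSum_bounds hd hM hS hN
    have hMS : IsPairMatching G S := hM.1.subset subset_union_left
    have hMN : IsPairMatching G N := hM.1.subset subset_union_right
    have hcardM : #(S ∪ N) = #S + #N := card_union_of_disjoint hd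
    have hU : #(pairVerts (S ∪ N))ᶜ = 3 * t - 2 * (#S + #N) := by
      rw [card_compl, hM.1.card_pairVerts, ht, hcardM]
    have hverts : pairVerts (S ∪ N) = pairVerts S ∪ pairVerts N := by
      ext v
      simp only [mem_union, mem_pairVerts]
      grind
    have hdSN : Disjoint (pairVerts S) (pairVerts N) := by
      rw [Finset.disjoint_left]
      intro v hvS hvN
      obtain ⟨p, hp, hvp⟩ := mem_pairVerts.1 hvS
      obtain ⟨q, hq, hvq⟩ := mem_pairVerts.1 hvN
      have := hM.1.2 p (mem_union_left _ hp) q (mem_union_right _ hq) (by grind)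
      subst this
      exact Finset.disjoint_left.1 hd hp hq
    set U := (pairVerts (S ∪ N))ᶜ with hUdef
    have hUv : Disjoint (pairVerts (S ∪ N)) U := disjoint_compl_right
    rw [hverts, disjoint_union_left] at hUv
    -- Fewer than n/3 matching edges leave more than n/3 free vertices, enough to extend all of `S`.
    have T1 := hMS.hasPartialTiling_union hUv.1 (by omega)
    have T := T1.union hMN.hasPartialTiling_pairVerts
      (disjoint_union_left.2 ⟨hdSN, hUv.2.symm⟩)
    refine T.mono (subset_univ _) ?_
    rw [hsum] at hedges
    have hE := edgeSum_le_card_mul_card (G := G) (pairVerts N) (pairVerts N)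
    rw [hMN.card_pairVerts] at hE
    push_cast at hE
    have hlt' : (3 : ℝ) * (#S + #N) ≤ Fintype.card V := by
      rw [ht]; exact_mod_cast (by omega : 3 * (#S + #N) ≤ 3 * t)
    have hu : (#U : ℝ) = (Fintype.card V : ℝ) - 2 * #S - 2 * #N := by
      rw [hU, ht, Nat.cast_sub (by omega)]
      push_cast; ring
    have hn : (1 : ℝ) ≤ Fintype.card V := by
      rw [ht]; exact_mod_cast (by omega : 1 ≤ 3 * t)
    have := tiling_bound_of_edge_bounds hn (Nat.cast_nonneg #S) (Nat.cast_nonneg #N) hlt' hu hX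
      (by nlinarith) (edgeSum_nonneg _ _) hedges
    linarith

end TriangleFactor

/-! ### Conclusion -/

lemma isLittleO_const_natCast (C : ℝ) :
    (fun _ : ℕ => C) =o[Filter.atTop] (fun n : ℕ => (n : ℝ)) :=
  (Asymptotics.isLittleO_const_id_atTop C).comp_tendsto tendsto_natCast_atTop_atTop

theorem theorem2 :
    (∃ f : ℕ → ℝ, f =o[Filter.atTop] (fun n : ℕ => (n : ℝ)) ∧
      ∀ n : ℕ, 4 ≤ n → ∀ c : SimpleGraph.TopEdgeLabeling (Fin n) ℤˣ, IsBalancedLabeling c →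
        ∃ (v : Fin n) (C : (⊤ : SimpleGraph (Fin n)).Walk v v), C.IsHamiltonianCycle ∧
          (2 - Real.sqrt 2) * (n : ℝ) - f n ≤ (plusCount c C.toSubgraph.spanningCoe : ℝ)) ∧
    (∃ f : ℕ → ℝ, f =o[Filter.atTop] (fun n : ℕ => (n : ℝ)) ∧
      ∀ n : ℕ, 3 ∣ n → ∀ c : SimpleGraph.TopEdgeLabeling (Fin n) ℤˣ, IsBalancedLabeling c →
        ∃ F : SimpleGraph (Fin n), IsTriangleFactor F ∧
          (3 * Real.sqrt 2 / 4 - 1 / 2) * (n : ℝ) - f n ≤ (plusCount c F : ℝ)) := by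
  refine ⟨⟨fun _ => 3, isLittleO_const_natCast 3, fun n hn c hc => ?_⟩,
    ⟨fun _ => 13, isLittleO_const_natCast 13, fun n hn c hc => ?_⟩⟩
  · obtain ⟨l, hl, hle⟩ := exists_cycleSum_ge (by rw [Fintype.card_fin]; omega)
      (sum_adjInd_of_isBalancedLabeling hc)
    obtain ⟨v, C, hC, hCle⟩ := exists_isHamiltonianCycle_plusCount_ge (by omega) c hl
    rw [Fintype.card_fin] at hle
    exact ⟨v, C, hC, hle.trans hCle⟩
  · have hT := exists_hasPartialTiling (by rwa [Fintype.card_fin])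
      (sum_adjInd_of_isBalancedLabeling hc)
    obtain ⟨F, hF, hle⟩ := hT.exists_isTriangleFactor hn
    rw [Fintype.card_fin] at hle
    refine ⟨F, hF, le_trans ?_ hle⟩
    -- The rational 0.561 lies just above 3√2/4 - 1/2 ≈ 0.5607.
    have hs : Real.sqrt 2 ≤ 1.4143 := Real.sqrt_le_iff.2 ⟨by norm_num, by norm_num⟩
    have : (0 : ℝ) ≤ n := Nat.cast_nonneg n
    have := mul_le_mul_of_nonneg_right
      (show 3 * Real.sqrt 2 / 4 - 1 / 2 ≤ 561 / 1000 by linarith) this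
    linarith
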